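/- Consider the calculus $\lambda_{\text{æ}}$ of asynchronous effects, without general recursion and without reinstallable interrupt handlers, over a finite set $\Sigma$ of operation names and a set of base types, where each $\mathsf{op}\in\Sigma$ has a payload type $A_{\mathsf{op}}$ that is a base type. *Syntax.* Values are $V ::= x \mid \mathsf{fun}\,(x:X)\mapsto M \mid \langle V\rangle$. Computations are $$M ::= \mathsf{return}\,V \mid \mathsf{let}\;x=M\;\mathsf{in}\;N \mid V\,W \mid \uparrow\!\mathsf{op}(V,M) \mid \downarrow\!\mathsf{op}(V,M) \mid \mathsf{promise}\,(\mathsf{op}\,x\mapsto M)\;\mathsf{as}\;p\;\mathsf{in}\;N \mid \mathsf{await}\;V\;\mathsf{until}\;\langle x\rangle\;\mathsf{in}\;M .$$ Value types are $X ::= b \mid X\to Y\,!\,(o,\iota) \mid \langle X\rangle$ with $b$ a base type. Effect annotations are pairs $(o,\iota)$ with $o\in O=\mathcal P(\Sigma)$ and $\iota$ in the least fixed point $I$ of $\Phi(Z)=\Sigma\Rightarrow(O\times Z)_\bot$ (finite annotations), ordered by $o\subseteq o'$ and, recursively pointwise, $\iota\sqsubseteq\iota'$ (with $\bot$ least). Joins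 $\sqcup$ are union and the recursively pointwise join. If $\iota(\mathsf{op})=(o',\iota')$, put $\mathsf{op}\downarrow(o,\iota)=(o\cup o',\ \iota[\mathsf{op}\mapsto\bot]\sqcup\iota')$; otherwise put $\mathsf{op}\downarrow(o,\iota)=(o,\iota)$. *Typing.* $\Gamma\vdash V:X$ and $\Gamma\vdash M:X\,!\,(o,\iota)$ are given by the usual fine-grain call-by-value rules for variables, functions, application, $\mathsf{return}$ (at any annotation) and $\mathsf{let}$ (both parts at the annotation of the whole), by $\Gamma\vdash\langle V\rangle:\langle X\rangle$ if $\Gamma\vdash V:X$, and by the rules: * $\uparrow\!\mathsf{op}(V,M):X\,!\,(o,\iota)$ if $\mathsf{op}\in o$, $V:A_{\mathsf{op}}$ and $M:X\,!\,(o,\iota)$; * $\downarrow\!\mathsf{op}(V,M):X\,!\,\mathsf{op}\downarrow(o,\iota)$ if $V:A_{\mathsf{op}}$ and $M:X\,!\,(o,\iota)$; * $\mathsf{promise}\,(\mathsf{op}\,x\mapsto M)\;\mathsf{as}\;p\;\mathsf{in}\;N:Y\,!\,(o,\iota)$ if $\iota(\mathsf{op})=(o',\iota')$, $\Gamma,x:A_{\mathsf{op}}\vdash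 M:\langle X\rangle\,!\,(o',\iota')$ and $\Gamma,p:\langle X\rangle\vdash N:Y\,!\,(o,\iota)$; * $\mathsf{await}\;V\;\mathsf{until}\;\langle x\rangle\;\mathsf{in}\;M:Y\,!\,(o,\iota)$ if $V:\langle X\rangle$ and $\Gamma,x:X\vdash M:Y\,!\,(o,\iota)$; * $M:X\,!\,(o',\iota')$ if $M:X\,!\,(o,\iota)$ and $(o,\iota)\sqsubseteq(o',\iota')$. *Reduction of computations.* $M\rightsquigarrow N$ is generated by the following rules (bound variables are renamed to avoid capture; in the rule reducing $H_{\mathsf{op}}[\uparrow\!\mathsf{op}'(V,N)]$, the variable $p$ does not occur in $V$), where $H_{\mathsf{op}}[N]$ abbreviates $\mathsf{promise}\,(\mathsf{op}\,x\mapsto M)\;\mathsf{as}\;p\;\mathsf{in}\;N$ and $W_V[N]$ abbreviates $\mathsf{await}\;V\;\mathsf{until}\;\langle y\rangle\;\mathsf{in}\;N$: * $(\mathsf{fun}\,(x:X)\mapsto M)\,V\rightsquigarrow M[V/x]$; $\ \mathsf{let}\;x=\mathsf{return}\,V\;\mathsf{in}\;M\rightsquigarrow M[V/x]$; $\ \mathsf{await}\;\langle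 V\rangle\;\mathsf{until}\;\langle x\rangle\;\mathsf{in}\;M\rightsquigarrow M[V/x]$; * $\mathsf{let}\;z=\uparrow\!\mathsf{op}(V,M)\;\mathsf{in}\;N\rightsquigarrow\ \uparrow\!\mathsf{op}(V,\mathsf{let}\;z=M\;\mathsf{in}\;N)$; * $\mathsf{let}\;z=H_{\mathsf{op}}[N_1]\;\mathsf{in}\;N_2\rightsquigarrow H_{\mathsf{op}}[\mathsf{let}\;z=N_1\;\mathsf{in}\;N_2]$; $\ \mathsf{let}\;z=W_V[M]\;\mathsf{in}\;N\rightsquigarrow W_V[\mathsf{let}\;z=M\;\mathsf{in}\;N]$; * $H_{\mathsf{op}}[\uparrow\!\mathsf{op}'(V,N)]\rightsquigarrow\ \uparrow\!\mathsf{op}'(V,H_{\mathsf{op}}[N])$; * $\downarrow\!\mathsf{op}(V,\mathsf{return}\,W)\rightsquigarrow\mathsf{return}\,W$; $\ \downarrow\!\mathsf{op}(V,\uparrow\!\mathsf{op}'(W,M))\rightsquigarrow\ \uparrow\!\mathsf{op}'(W,\downarrow\!\mathsf{op}(V,M))$; $\ \downarrow\!\mathsf{op}(V,W_U[M])\rightsquigarrow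 W_U[\downarrow\!\mathsf{op}(V,M)]$; * $\downarrow\!\mathsf{op}(V,H_{\mathsf{op}}[N])\rightsquigarrow\mathsf{let}\;p=M[V/x]\;\mathsf{in}\;\downarrow\!\mathsf{op}(V,N)$; $\ \downarrow\!\mathsf{op}'(V,H_{\mathsf{op}}[N])\rightsquigarrow H_{\mathsf{op}}[\downarrow\!\mathsf{op}'(V,N)]$ if $\mathsf{op}\neq\mathsf{op}'$; * $\mathcal E[M]\rightsquigarrow\mathcal E[N]$ if $M\rightsquigarrow N$, for $\mathcal E::=[\,]\mid\mathsf{let}\;x=\mathcal E\;\mathsf{in}\;N\mid\uparrow\!\mathsf{op}(V,\mathcal E)\mid\downarrow\!\mathsf{op}(V,\mathcal E)\mid\mathsf{promise}\,(\mathsf{op}\,x\mapsto M)\;\mathsf{as}\;p\;\mathsf{in}\;\mathcal E$. *Flat processes.* A process is a non-empty list $P=M_1\,||\,\cdots\,||\,M_n$ of computations. It is well-typed, $\Gamma\vdash P$, if every $M_i$ satisfies $\Gamma\vdash M_i:X_i\,!\,(o_i,\iota_i)$ for some value type $X_i$ and some (finite) effect annotation $(o_i,\iota_i)$. Processes reduce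 by $$M_1||\cdots||M_i||\cdots||M_n\rightsquigarrow M_1||\cdots||M_i'||\cdots||M_n\quad\text{if } M_i\rightsquigarrow M_i',$$ $$M_1||\cdots||\uparrow\!\mathsf{op}(V,M_i)||\cdots||M_n\rightsquigarrow\ \downarrow\!\mathsf{op}(V,M_1)||\cdots||M_i||\cdots||\downarrow\!\mathsf{op}(V,M_n),$$ the second rule turning a signal of the $i$-th computation into an interrupt for all the other computations. **Theorem.** Every well-typed flat process $\Gamma\vdash P$ is strongly normalising: there is no infinite reduction sequence $P\rightsquigarrow P'\rightsquigarrow P''\rightsquigarrow\cdots$. -/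

import Mathlib

/-!
The calculus of asynchronous effects without general recursion and without reinstallable
interrupt handlers: effect annotations, types, terms (in de Bruijn form), effect typing,
small-step semantics of computations, and the flat (list-based) model of parallel processes.

`S` is the set of operation names, `B` is the set of base types.
-/

universe u v

namespace AEff

/-! ### Finite effect annotations -/

/-- The values taken by a finite effect annotation: either undefined (`bot`), or a pair of a set
of signals and a further annotation. With `Ann S := S → Entry S`, the type `Entry S` is
the disjoint union of `{⊥}` and `Set S × Ann S`, so `Ann S` is the least fixed point of
`X ↦ (S → (Set S × X)_⊥)`. -/
inductive Entry (S : Type u) : Type u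
  | bot : Entry S
  | node : Set S → (S → Entry S) → Entry S

/-- Finite (inductively generated) interrupt annotations `ι`. -/
abbrev Ann (S : Type u) : Type u := S → Entry S

/-- Effect annotations `(o, ι)`. -/
abbrev Eff (S : Type u) : Type u := Set S × Ann S

/-- The order on entries: `⊥` is least, and pairs are compared componentwise. -/
def Entry.le {S : Type u} : Entry S → Entry S → Prop
  | .bot, _ => True
  | .node _ _, .bot => False
  | .node o i, .node o' i' => o ⊆ o' ∧ ∀ s, Entry.le (i s) (i' s)

/-- The join of entries: `⊥` is neutral, and pairs are joined componentwise. -/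
def Entry.sup {S : Type u} : Entry S → Entry S → Entry S
  | .bot, e => e
  | .node o i, .bot => .node o i
  | .node o i, .node o' i' => .node (o ∪ o') (fun s => Entry.sup (i s) (i' s))

/-- The pointwise order on annotations. -/
def Ann.le {S : Type u} (i i' : Ann S) : Prop := ∀ s, (i s).le (i' s)

/-- The pointwise join of annotations. -/
def Ann.sup {S : Type u} (i i' : Ann S) : Ann S := fun s => (i s).sup (i' s)

/-- The sub-effecting order `(o, ι) ⊑ (o', ι')`. -/
def Eff.le {S : Type u} (e e' : Eff S) : Prop := e.1 ⊆ e'.1 ∧ Ann.le e.2 e'.2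

/-- The action `op ↓ (o, ι)` of an interrupt on an effect annotation:
`(o ∪ o', ι[op ↦ ⊥] ⊔ ι')` if `ι op = (o', ι')`, and `(o, ι)` if `ι op = ⊥`. -/
def Eff.act {S : Type u} [DecidableEq S] (op : S) (e : Eff S) : Eff S :=
  match e.2 op with
  | .bot => e
  | .node o' i' => (e.1 ∪ o', Ann.sup (Function.update e.2 op Entry.bot) i')

/-! ### Types and terms -/

/-- Value types: base types, function types `X → Y ! (o, ι)`, and promise types `⟨X⟩`. -/
inductive VTy (S : Type u) (B : Type v) : Type (max u v)
  | base : B → VTy S B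
  | arrow : VTy S B → VTy S B → Eff S → VTy S B
  | promise : VTy S B → VTy S B

mutual

/-- Values. Variables are de Bruijn indices. -/
inductive Val (S : Type u) (B : Type v) : Type (max u v)
  | var : ℕ → Val S B
  /-- `fun (x : X) ↦ M`, binding `x` in `M`. -/
  | lam : VTy S B → Cmp S B → Val S B
  /-- the fulfilled promise `⟨V⟩` -/
  | promise : Val S B → Val S B

/-- Computations. -/
inductive Cmp (S : Type u) (B : Type v) : Type (max u v)
  /-- `return V` -/
  | ret : Val S B → Cmp S B
  /-- `let x = M in N`, binding `x` in `N`. -/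
  | letin : Cmp S B → Cmp S B → Cmp S B
  /-- `V W` -/
  | app : Val S B → Val S B → Cmp S B
  /-- the outgoing signal `↑ op (V, M)` -/
  | signal : S → Val S B → Cmp S B → Cmp S B
  /-- the incoming interrupt `↓ op (V, M)` -/
  | interrupt : S → Val S B → Cmp S B → Cmp S B
  /-- `promise (op x ↦ M) as p in N`, binding `x` in `M` and `p` in `N`. -/
  | handler : S → Cmp S B → Cmp S B → Cmp S B
  /-- `await V until ⟨x⟩ in M`, binding `x` in `M`. -/
  | await : Val S B → Cmp S B → Cmp S B

end

/-- Lifting of a renaming under a binder. -/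
def liftRen (ρ : ℕ → ℕ) : ℕ → ℕ
  | 0 => 0
  | n + 1 => ρ n + 1

mutual

/-- Action of a renaming on a value. -/
def Val.rename {S : Type u} {B : Type v} (ρ : ℕ → ℕ) : Val S B → Val S B
  | .var n => .var (ρ n)
  | .lam X M => .lam X (M.rename (liftRen ρ))
  | .promise V => .promise (V.rename ρ)

/-- Action of a renaming on a computation. -/
def Cmp.rename {S : Type u} {B : Type v} (ρ : ℕ → ℕ) : Cmp S B → Cmp S B
  | .ret V => .ret (V.rename ρ)
  | .letin M N => .letin (M.rename ρ) (N.rename (liftRen ρ))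
  | .app V W => .app (V.rename ρ) (W.rename ρ)
  | .signal op V M => .signal op (V.rename ρ) (M.rename ρ)
  | .interrupt op V M => .interrupt op (V.rename ρ) (M.rename ρ)
  | .handler op M N => .handler op (M.rename (liftRen ρ)) (N.rename (liftRen ρ))
  | .await V M => .await (V.rename ρ) (M.rename (liftRen ρ))

end

/-- Weakening of a value by one fresh innermost variable. -/
def Val.wk {S : Type u} {B : Type v} (V : Val S B) : Val S B := V.rename Nat.succ

/-- Weakening of the body of a binder by one fresh variable directly outside of that binder:
index `0` stays, all other indices are shifted. -/
def Cmp.wkUnder {S : Type u} {B : Type v} (M : Cmp S B) : Cmp S B :=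
  M.rename (liftRen Nat.succ)

/-- Lifting of a substitution under a binder. -/
def liftSub {S : Type u} {B : Type v} (σ : ℕ → Val S B) : ℕ → Val S B
  | 0 => .var 0
  | n + 1 => (σ n).wk

mutual

/-- Parallel capture-avoiding substitution in a value. -/
def Val.subst {S : Type u} {B : Type v} (σ : ℕ → Val S B) : Val S B → Val S B
  | .var n => σ n
  | .lam X M => .lam X (M.subst (liftSub σ))
  | .promise V => .promise (V.subst σ)

/-- Parallel capture-avoiding substitution in a computation. -/
def Cmp.subst {S : Type u} {B : Type v} (σ : ℕ → Val S B) : Cmp S B → Cmp S B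
  | .ret V => .ret (V.subst σ)
  | .letin M N => .letin (M.subst σ) (N.subst (liftSub σ))
  | .app V W => .app (V.subst σ) (W.subst σ)
  | .signal op V M => .signal op (V.subst σ) (M.subst σ)
  | .interrupt op V M => .interrupt op (V.subst σ) (M.subst σ)
  | .handler op M N => .handler op (M.subst (liftSub σ)) (N.subst (liftSub σ))
  | .await V M => .await (V.subst σ) (M.subst (liftSub σ))

end

/-- The substitution that maps index `0` to `V` and lowers all other indices by one. -/
def singleSub {S : Type u} {B : Type v} (V : Val S B) : ℕ → Val S B
  | 0 => V
  | n + 1 => .var n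

/-- `M[V/x]`, where `x` is the innermost variable of `M`. -/
def Cmp.inst {S : Type u} {B : Type v} (M : Cmp S B) (V : Val S B) : Cmp S B :=
  M.subst (singleSub V)

/-! ### Effect typing -/

/-- Contexts; the head of the list is the type of the innermost variable. -/
abbrev Ctx (S : Type u) (B : Type v) : Type (max u v) := List (VTy S B)

mutual

/-- `Γ ⊢ V : X`, relative to the signature `A` that gives the payload type of each operation. -/
inductive HasVTy {S : Type u} {B : Type v} [DecidableEq S] (A : S → B) :
    Ctx S B → Val S B → VTy S B → Prop
  | var {Γ : Ctx S B} {n : ℕ} {X : VTy S B} :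
      Γ[n]? = some X → HasVTy A Γ (.var n) X
  | lam {Γ : Ctx S B} {X Y : VTy S B} {e : Eff S} {M : Cmp S B} :
      HasCTy A (X :: Γ) M Y e → HasVTy A Γ (.lam X M) (.arrow X Y e)
  | promise {Γ : Ctx S B} {X : VTy S B} {V : Val S B} :
      HasVTy A Γ V X → HasVTy A Γ (.promise V) (.promise X)

/-- `Γ ⊢ M : X ! (o, ι)`, where the last argument is the pair `(o, ι)`. -/
inductive HasCTy {S : Type u} {B : Type v} [DecidableEq S] (A : S → B) :
    Ctx S B → Cmp S B → VTy S B → Eff S → Prop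
  | ret {Γ : Ctx S B} {V : Val S B} {X : VTy S B} {e : Eff S} :
      HasVTy A Γ V X → HasCTy A Γ (.ret V) X e
  | letin {Γ : Ctx S B} {M N : Cmp S B} {X Y : VTy S B} {e : Eff S} :
      HasCTy A Γ M X e → HasCTy A (X :: Γ) N Y e → HasCTy A Γ (.letin M N) Y e
  | app {Γ : Ctx S B} {V W : Val S B} {X Y : VTy S B} {e : Eff S} :
      HasVTy A Γ V (.arrow X Y e) → HasVTy A Γ W X → HasCTy A Γ (.app V W) Y e
  | signal {Γ : Ctx S B} {op : S} {V : Val S B} {M : Cmp S B} {X : VTy S B} {e : Eff S} :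
      op ∈ e.1 → HasVTy A Γ V (.base (A op)) → HasCTy A Γ M X e →
      HasCTy A Γ (.signal op V M) X e
  | interrupt {Γ : Ctx S B} {op : S} {V : Val S B} {M : Cmp S B} {X : VTy S B} {e : Eff S} :
      HasVTy A Γ V (.base (A op)) → HasCTy A Γ M X e →
      HasCTy A Γ (.interrupt op V M) X (Eff.act op e)
  | handler {Γ : Ctx S B} {op : S} {M N : Cmp S B} {X Y : VTy S B} {e : Eff S}
      {o' : Set S} {i' : Ann S} :
      e.2 op = Entry.node o' i' →
      HasCTy A (.base (A op) :: Γ) M (.promise X) (o', i') →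
      HasCTy A (.promise X :: Γ) N Y e →
      HasCTy A Γ (.handler op M N) Y e
  | await {Γ : Ctx S B} {V : Val S B} {M : Cmp S B} {X Y : VTy S B} {e : Eff S} :
      HasVTy A Γ V (.promise X) → HasCTy A (X :: Γ) M Y e → HasCTy A Γ (.await V M) Y e
  | sub {Γ : Ctx S B} {M : Cmp S B} {X : VTy S B} {e e' : Eff S} :
      HasCTy A Γ M X e → Eff.le e e' → HasCTy A Γ M X e'

end

/-! ### Small-step semantics of computations -/

/-- One-step reduction `M ⟶ N` of computations. The last four constructors are the closure under
evaluation contexts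
`E ::= [ ] | let x = E in N | ↑ op (V, E) | ↓ op (V, E) | promise (op x ↦ M) as p in E`. -/
inductive Cmp.Step {S : Type u} {B : Type v} : Cmp S B → Cmp S B → Prop
  | beta (X : VTy S B) (M : Cmp S B) (V : Val S B) :
      Cmp.Step (.app (.lam X M) V) (M.inst V)
  | let_ret (V : Val S B) (M : Cmp S B) :
      Cmp.Step (.letin (.ret V) M) (M.inst V)
  | let_signal (op : S) (V : Val S B) (M N : Cmp S B) :
      Cmp.Step (.letin (.signal op V M) N) (.signal op V (.letin M N))
  | let_handler (op : S) (M N₁ N₂ : Cmp S B) :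
      Cmp.Step (.letin (.handler op M N₁) N₂) (.handler op M (.letin N₁ N₂.wkUnder))
  | let_await (V : Val S B) (M N : Cmp S B) :
      Cmp.Step (.letin (.await V M) N) (.await V (.letin M N.wkUnder))
  /-- The payload `V` must not mention the promise variable, so in the redex it is a weakening.
  For well-typed redexes this is automatic, as payloads have base types. -/
  | handler_signal (op op' : S) (V : Val S B) (M N : Cmp S B) :
      Cmp.Step (.handler op M (.signal op' V.wk N)) (.signal op' V (.handler op M N))
  | interrupt_ret (op : S) (V W : Val S B) :
      Cmp.Step (.interrupt op V (.ret W)) (.ret W)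
  | interrupt_signal (op op' : S) (V W : Val S B) (M : Cmp S B) :
      Cmp.Step (.interrupt op V (.signal op' W M)) (.signal op' W (.interrupt op V M))
  | interrupt_handler_same (op : S) (V : Val S B) (M N : Cmp S B) :
      Cmp.Step (.interrupt op V (.handler op M N))
        (.letin (M.inst V) (.interrupt op V.wk N))
  | interrupt_handler_ne (op op' : S) (V : Val S B) (M N : Cmp S B) : op ≠ op' →
      Cmp.Step (.interrupt op' V (.handler op M N)) (.handler op M (.interrupt op' V.wk N))
  | interrupt_await (op : S) (V W : Val S B) (M : Cmp S B) :
      Cmp.Step (.interrupt op V (.await W M)) (.await W (.interrupt op V.wk M))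
  | await_promise (V : Val S B) (M : Cmp S B) :
      Cmp.Step (.await (.promise V) M) (M.inst V)
  | ctx_let {M M' : Cmp S B} (N : Cmp S B) :
      Cmp.Step M M' → Cmp.Step (.letin M N) (.letin M' N)
  | ctx_signal (op : S) (V : Val S B) {M M' : Cmp S B} :
      Cmp.Step M M' → Cmp.Step (.signal op V M) (.signal op V M')
  | ctx_interrupt (op : S) (V : Val S B) {M M' : Cmp S B} :
      Cmp.Step M M' → Cmp.Step (.interrupt op V M) (.interrupt op V M')
  | ctx_handler (op : S) (M : Cmp S B) {N N' : Cmp S B} :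
      Cmp.Step N N' → Cmp.Step (.handler op M N) (.handler op M N')

/-! ### The flat model of parallel processes -/

/-- Flat processes `M₁ || … || Mₙ`, as lists of computations; non-emptiness is part of
well-formedness, see `Proc.WellTyped`. -/
abbrev Proc (S : Type u) (B : Type v) : Type (max u v) := List (Cmp S B)

/-- The process typing `Γ ⊢ P`: the process `P` is a non-empty list of computations, each of
which is well-typed in `Γ` at some computation type `X ! (o, ι)`. -/
def Proc.WellTyped {S : Type u} {B : Type v} [DecidableEq S] (A : S → B) (Γ : Ctx S B)
    (P : Proc S B) : Prop :=
  P ≠ [] ∧ ∀ M ∈ P, ∃ (X : VTy S B) (e : Eff S), HasCTy A Γ M X e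

/-- `Proc.Broadcast op V P Q`: one of the computations in `P` issues the signal `op` with payload
`V`, and all the other computations in `P` receive it as an interrupt. -/
inductive Proc.Broadcast {S : Type u} {B : Type v} (op : S) (V : Val S B) :
    Proc S B → Proc S B → Prop
  | here (M : Cmp S B) (P : Proc S B) :
      Proc.Broadcast op V (Cmp.signal op V M :: P) (M :: P.map (Cmp.interrupt op V))
  | there (M : Cmp S B) {P Q : Proc S B} :
      Proc.Broadcast op V P Q → Proc.Broadcast op V (M :: P) (Cmp.interrupt op V M :: Q)

/-- One-step reduction `P ⟶ Q` of flat processes. -/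
inductive Proc.Step {S : Type u} {B : Type v} : Proc S B → Proc S B → Prop
  | run (P₁ P₂ : Proc S B) {M M' : Cmp S B} :
      Cmp.Step M M' → Proc.Step (P₁ ++ M :: P₂) (P₁ ++ M' :: P₂)
  | broadcast {op : S} {V : Val S B} {P Q : Proc S B} :
      Proc.Broadcast op V P Q → Proc.Step P Q

/-- `P` is strongly normalising: there is no infinite reduction sequence starting from `P`. -/
def Proc.StronglyNormalising {S : Type u} {B : Type v} (P : Proc S B) : Prop :=
  ¬ ∃ f : ℕ → Proc S B, f 0 = P ∧ ∀ n, Proc.Step (f n) (f (n + 1))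

end AEff

/-!
Strong normalisation of flat processes of asynchronous effects.

Well-typed computations are strongly normalising for reasons that do not involve effect
annotations (`HasCTy.sn`). The proof is a biorthogonality argument: a computation of type `X` is
reducible if it normalises in every stack of frames `let x = [ ] in N` and `↓ op (V, [ ])` in which
all reducible values of type `X` normalise. Such stacks are inert. Signals, handlers and awaits move
out of them, and this is harmless: `E[↑ op (V, N)]` normalises if `E[N]` does
(`Cmp.SN.plug_signal`), and a handler around `N` may be replaced by the instances of `N` at
reducible promises (`sn_plug_handler`). Biorthogonality matters here because the type of the promise
made by a handler is unrelated to the type of the computation, so that a predicate mentioning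
handlers directly could not be defined by recursion on types. A normalising computation also emits
only finitely many signals on its own (`Cmp.SN.emitSN`).

In a process, computations moreover receive interrupts without bound. Call an interrupt `op`
effective for a computation at `(o, ι)` if `ι` is defined at `op`. An effective interrupt strictly
decreases the number of nodes of `ι`, which is finite because `S` is (`Eff.size_act_lt`). An
ineffective interrupt does not change the annotation and cannot trigger a handler, so it can be
erased: the relation `ErasesC` between a typed computation and the result of erasing some
ineffective interrupts is a simulation (`ErasesC.step`). Hence, as long as no effective interrupt
arrives, the erasure takes part in all emissions of a computation, and in all reductions except
those of erased interrupts, while ignoring new interrupts. So only finitely many signals are broadcast. Altogether, a process decreases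
lexicographically in the total size of its annotations, the multiset of the erasures of its
components, and the multiset of the components themselves (`acc_of_good`).
-/

namespace AEff

/-! ### Algebra of renamings and substitutions -/

section Substitution

variable {S : Type u} {B : Type v}

theorem liftRen_comp (ρ ρ' : ℕ → ℕ) : liftRen ρ' ∘ liftRen ρ = liftRen (ρ' ∘ ρ) := by
  funext n; cases n <;> rfl

mutual

theorem Val.rename_rename (ρ ρ' : ℕ → ℕ) :
    ∀ V : Val S B, (V.rename ρ).rename ρ' = V.rename (ρ' ∘ ρ)
  | .var n => rfl
  | .lam X M => by
      simp only [Val.rename, Cmp.rename_rename _ _ M, liftRen_comp]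
  | .promise V => by simp only [Val.rename, Val.rename_rename _ _ V]

theorem Cmp.rename_rename (ρ ρ' : ℕ → ℕ) :
    ∀ M : Cmp S B, (M.rename ρ).rename ρ' = M.rename (ρ' ∘ ρ)
  | .ret V => by simp only [Cmp.rename, Val.rename_rename _ _ V]
  | .letin M N => by
      simp only [Cmp.rename, Cmp.rename_rename _ _ M, Cmp.rename_rename _ _ N, liftRen_comp]
  | .app V W => by simp only [Cmp.rename, Val.rename_rename _ _ V, Val.rename_rename _ _ W]
  | .signal _ V M => by
      simp only [Cmp.rename, Val.rename_rename _ _ V, Cmp.rename_rename _ _ M]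
  | .interrupt _ V M => by
      simp only [Cmp.rename, Val.rename_rename _ _ V, Cmp.rename_rename _ _ M]
  | .handler _ M N => by
      simp only [Cmp.rename, Cmp.rename_rename _ _ M, Cmp.rename_rename _ _ N, liftRen_comp]
  | .await V M => by
      simp only [Cmp.rename, Val.rename_rename _ _ V, Cmp.rename_rename _ _ M, liftRen_comp]

end

theorem liftSub_comp_liftRen (ρ : ℕ → ℕ) (σ : ℕ → Val S B) :
    liftSub σ ∘ liftRen ρ = liftSub (σ ∘ ρ) := by
  funext n; cases n <;> rfl

mutual

theorem Val.subst_rename (ρ : ℕ → ℕ) (σ : ℕ → Val S B) :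
    ∀ V : Val S B, (V.rename ρ).subst σ = V.subst (σ ∘ ρ)
  | .var n => rfl
  | .lam X M => by
      simp only [Val.rename, Val.subst, Cmp.subst_rename _ _ M, liftSub_comp_liftRen]
  | .promise V => by simp only [Val.rename, Val.subst, Val.subst_rename _ _ V]

theorem Cmp.subst_rename (ρ : ℕ → ℕ) (σ : ℕ → Val S B) :
    ∀ M : Cmp S B, (M.rename ρ).subst σ = M.subst (σ ∘ ρ)
  | .ret V => by simp only [Cmp.rename, Cmp.subst, Val.subst_rename _ _ V]
  | .letin M N => by
      simp only [Cmp.rename, Cmp.subst, Cmp.subst_rename _ _ M, Cmp.subst_rename _ _ N,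
        liftSub_comp_liftRen]
  | .app V W => by
      simp only [Cmp.rename, Cmp.subst, Val.subst_rename _ _ V, Val.subst_rename _ _ W]
  | .signal _ V M => by
      simp only [Cmp.rename, Cmp.subst, Val.subst_rename _ _ V, Cmp.subst_rename _ _ M]
  | .interrupt _ V M => by
      simp only [Cmp.rename, Cmp.subst, Val.subst_rename _ _ V, Cmp.subst_rename _ _ M]
  | .handler _ M N => by
      simp only [Cmp.rename, Cmp.subst, Cmp.subst_rename _ _ M, Cmp.subst_rename _ _ N,
        liftSub_comp_liftRen]
  | .await V M => by
      simp only [Cmp.rename, Cmp.subst, Val.subst_rename _ _ V, Cmp.subst_rename _ _ M,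
        liftSub_comp_liftRen]

end

theorem rename_liftSub (σ : ℕ → Val S B) (ρ : ℕ → ℕ) :
    (fun n => (liftSub σ n).rename (liftRen ρ)) = liftSub (fun n => (σ n).rename ρ) := by
  funext n
  cases n with
  | zero => rfl
  | succ n => simp only [liftSub, Val.wk, Val.rename_rename]; rfl

mutual

theorem Val.rename_subst (σ : ℕ → Val S B) (ρ : ℕ → ℕ) :
    ∀ V : Val S B, (V.subst σ).rename ρ = V.subst (fun n => (σ n).rename ρ)
  | .var n => rfl
  | .lam X M => by
      simp only [Val.rename, Val.subst, Cmp.rename_subst _ _ M, rename_liftSub]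
  | .promise V => by simp only [Val.rename, Val.subst, Val.rename_subst _ _ V]

theorem Cmp.rename_subst (σ : ℕ → Val S B) (ρ : ℕ → ℕ) :
    ∀ M : Cmp S B, (M.subst σ).rename ρ = M.subst (fun n => (σ n).rename ρ)
  | .ret V => by simp only [Cmp.rename, Cmp.subst, Val.rename_subst _ _ V]
  | .letin M N => by
      simp only [Cmp.rename, Cmp.subst, Cmp.rename_subst _ _ M, Cmp.rename_subst _ _ N,
        rename_liftSub]
  | .app V W => by
      simp only [Cmp.rename, Cmp.subst, Val.rename_subst _ _ V, Val.rename_subst _ _ W]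
  | .signal _ V M => by
      simp only [Cmp.rename, Cmp.subst, Val.rename_subst _ _ V, Cmp.rename_subst _ _ M]
  | .interrupt _ V M => by
      simp only [Cmp.rename, Cmp.subst, Val.rename_subst _ _ V, Cmp.rename_subst _ _ M]
  | .handler _ M N => by
      simp only [Cmp.rename, Cmp.subst, Cmp.rename_subst _ _ M, Cmp.rename_subst _ _ N,
        rename_liftSub]
  | .await V M => by
      simp only [Cmp.rename, Cmp.subst, Val.rename_subst _ _ V, Cmp.rename_subst _ _ M,
        rename_liftSub]

end

theorem Val.wk_subst_liftSub (V : Val S B) (σ : ℕ → Val S B) :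
    V.wk.subst (liftSub σ) = (V.subst σ).wk := by
  simp only [Val.wk, Val.subst_rename, Val.rename_subst]; rfl

theorem subst_liftSub (σ τ : ℕ → Val S B) :
    (fun n => (liftSub σ n).subst (liftSub τ)) = liftSub (fun n => (σ n).subst τ) := by
  funext n
  cases n with
  | zero => rfl
  | succ n => exact Val.wk_subst_liftSub (σ n) τ

mutual

theorem Val.subst_subst (σ τ : ℕ → Val S B) :
    ∀ V : Val S B, (V.subst σ).subst τ = V.subst (fun n => (σ n).subst τ)
  | .var n => rfl
  | .lam X M => by simp only [Val.subst, Cmp.subst_subst _ _ M, subst_liftSub]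
  | .promise V => by simp only [Val.subst, Val.subst_subst _ _ V]

theorem Cmp.subst_subst (σ τ : ℕ → Val S B) :
    ∀ M : Cmp S B, (M.subst σ).subst τ = M.subst (fun n => (σ n).subst τ)
  | .ret V => by simp only [Cmp.subst, Val.subst_subst _ _ V]
  | .letin M N => by
      simp only [Cmp.subst, Cmp.subst_subst _ _ M, Cmp.subst_subst _ _ N, subst_liftSub]
  | .app V W => by simp only [Cmp.subst, Val.subst_subst _ _ V, Val.subst_subst _ _ W]
  | .signal _ V M => by simp only [Cmp.subst, Val.subst_subst _ _ V, Cmp.subst_subst _ _ M]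
  | .interrupt _ V M => by simp only [Cmp.subst, Val.subst_subst _ _ V, Cmp.subst_subst _ _ M]
  | .handler _ M N => by
      simp only [Cmp.subst, Cmp.subst_subst _ _ M, Cmp.subst_subst _ _ N, subst_liftSub]
  | .await V M => by
      simp only [Cmp.subst, Val.subst_subst _ _ V, Cmp.subst_subst _ _ M, subst_liftSub]

end

theorem liftSub_var : liftSub (Val.var : ℕ → Val S B) = Val.var := by
  funext n; cases n <;> rfl

mutual

theorem Val.subst_var : ∀ V : Val S B, V.subst .var = V
  | .var n => rfl
  | .lam X M => by simp only [Val.subst, liftSub_var, Cmp.subst_var M]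
  | .promise V => by simp only [Val.subst, Val.subst_var V]

theorem Cmp.subst_var : ∀ M : Cmp S B, M.subst .var = M
  | .ret V => by simp only [Cmp.subst, Val.subst_var V]
  | .letin M N => by simp only [Cmp.subst, liftSub_var, Cmp.subst_var M, Cmp.subst_var N]
  | .app V W => by simp only [Cmp.subst, Val.subst_var V, Val.subst_var W]
  | .signal _ V M => by simp only [Cmp.subst, Val.subst_var V, Cmp.subst_var M]
  | .interrupt _ V M => by simp only [Cmp.subst, Val.subst_var V, Cmp.subst_var M]
  | .handler _ M N => by simp only [Cmp.subst, liftSub_var, Cmp.subst_var M, Cmp.subst_var N]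
  | .await V M => by simp only [Cmp.subst, liftSub_var, Val.subst_var V, Cmp.subst_var M]

end

theorem singleSub_comp_succ (W : Val S B) : singleSub W ∘ Nat.succ = Val.var := rfl

theorem Val.wk_subst_singleSub (V W : Val S B) : V.wk.subst (singleSub W) = V := by
  rw [Val.wk, Val.subst_rename, singleSub_comp_succ, Val.subst_var]

/-- The substitution that maps index `0` to `V` and index `n + 1` to `σ n`. -/
def consSub (V : Val S B) (σ : ℕ → Val S B) : ℕ → Val S B
  | 0 => V
  | n + 1 => σ n

theorem Cmp.inst_subst_liftSub (M : Cmp S B) (σ : ℕ → Val S B) (V : Val S B) :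
    (M.subst (liftSub σ)).inst V = M.subst (consSub V σ) := by
  rw [Cmp.inst, Cmp.subst_subst]
  congr 1
  funext n
  cases n with
  | zero => rfl
  | succ n => exact Val.wk_subst_singleSub (σ n) V

theorem Cmp.subst_inst (M : Cmp S B) (V : Val S B) (σ : ℕ → Val S B) :
    (M.inst V).subst σ = (M.subst (liftSub σ)).inst (V.subst σ) := by
  rw [Cmp.inst_subst_liftSub, Cmp.inst, Cmp.subst_subst]
  congr 1
  funext n
  cases n <;> rfl

theorem Cmp.wkUnder_subst_liftSub (N : Cmp S B) (σ : ℕ → Val S B) :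
    N.wkUnder.subst (liftSub (liftSub σ)) = (N.subst (liftSub σ)).wkUnder := by
  rw [Cmp.wkUnder, Cmp.wkUnder, Cmp.subst_rename, Cmp.rename_subst, liftSub_comp_liftRen,
    rename_liftSub]
  rfl

theorem Cmp.wkUnder_subst_singleSub (N : Cmp S B) (W : Val S B) :
    N.wkUnder.subst (liftSub (singleSub W)) = N := by
  rw [Cmp.wkUnder, Cmp.subst_rename, liftSub_comp_liftRen, singleSub_comp_succ, liftSub_var,
    Cmp.subst_var]

/-- Reduction is stable under substitution. -/
theorem Cmp.Step.subst {M M' : Cmp S B} (h : Cmp.Step M M') :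
    ∀ σ : ℕ → Val S B, Cmp.Step (M.subst σ) (M'.subst σ) := by
  induction h with
  | beta X M V => intro σ; rw [Cmp.subst_inst]; exact .beta _ _ _
  | let_ret V M => intro σ; rw [Cmp.subst_inst]; exact .let_ret _ _
  | let_signal op V M N => intro σ; exact .let_signal _ _ _ _
  | let_handler op M N₁ N₂ =>
      intro σ
      simp only [Cmp.subst, Cmp.wkUnder_subst_liftSub]
      exact .let_handler _ _ _ _
  | let_await V M N =>
      intro σ
      simp only [Cmp.subst, Cmp.wkUnder_subst_liftSub]
      exact .let_await _ _ _
  | handler_signal op op' V M N =>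
      intro σ
      simp only [Cmp.subst, Val.wk_subst_liftSub]
      exact .handler_signal _ _ _ _ _
  | interrupt_ret op V W => intro σ; exact .interrupt_ret _ _ _
  | interrupt_signal op op' V W M => intro σ; exact .interrupt_signal _ _ _ _ _
  | interrupt_handler_same op V M N =>
      intro σ
      simp only [Cmp.subst, Cmp.subst_inst, Val.wk_subst_liftSub]
      exact .interrupt_handler_same _ _ _ _
  | interrupt_handler_ne op op' V M N hne =>
      intro σ
      simp only [Cmp.subst, Val.wk_subst_liftSub]
      exact .interrupt_handler_ne _ _ _ _ _ hne
  | interrupt_await op V W M =>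
      intro σ
      simp only [Cmp.subst, Val.wk_subst_liftSub]
      exact .interrupt_await _ _ _ _
  | await_promise V M => intro σ; rw [Cmp.subst_inst]; exact .await_promise _ _
  | ctx_let N _ ih => intro σ; exact .ctx_let _ (ih σ)
  | ctx_signal op V _ ih => intro σ; exact .ctx_signal _ _ (ih σ)
  | ctx_interrupt op V _ ih => intro σ; exact .ctx_interrupt _ _ (ih σ)
  | ctx_handler op M _ ih => intro σ; exact .ctx_handler _ _ (ih _)

end Substitution

/-! ### Strong normalisation and signal emission -/

section Normalisation

variable {S : Type u} {B : Type v}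

/-- Strong normalisation of a computation, as accessibility. -/
abbrev Cmp.SN (M : Cmp S B) : Prop := Acc (fun M' M : Cmp S B => Cmp.Step M M') M

/-- Reduction of a computation that may also emit its outermost signal. -/
inductive Cmp.EmitStep : Cmp S B → Cmp S B → Prop
  | run {M M' : Cmp S B} : Cmp.Step M M' → Cmp.EmitStep M M'
  | emit (op : S) (V : Val S B) (M : Cmp S B) : Cmp.EmitStep (.signal op V M) M

/-- Strong normalisation with respect to reduction and emission of signals. -/
abbrev Cmp.EmitSN (M : Cmp S B) : Prop := Acc (fun M' M : Cmp S B => Cmp.EmitStep M M') M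

/-- Prefixes a computation with a list of signals. -/
def Cmp.signals : List (S × Val S B) → Cmp S B → Cmp S B
  | [], M => M
  | (op, V) :: l, M => .signal op V (Cmp.signals l M)

theorem Cmp.Step.signals {M M' : Cmp S B} (h : Cmp.Step M M') :
    ∀ l : List (S × Val S B), Cmp.Step (Cmp.signals l M) (Cmp.signals l M')
  | [] => h
  | (_, _) :: l => .ctx_signal _ _ (h.signals l)

theorem Cmp.signals_append (l l' : List (S × Val S B)) (M : Cmp S B) :
    Cmp.signals (l ++ l') M = Cmp.signals l (Cmp.signals l' M) := by
  induction l with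
  | nil => rfl
  | cons a l ih => exact congrArg (Cmp.signal a.1 a.2) ih

/-- A reduction that happens after the emission of some signals could have happened below them,
and only finitely many signals can be emitted without reducing. -/
theorem Cmp.SN.emitSN {M : Cmp S B} (h : M.SN) : M.EmitSN := by
  suffices H : ∀ K : Cmp S B, K.SN → ∀ (n : ℕ) (M : Cmp S B) (l : List (S × Val S B)),
      sizeOf M < n → K = Cmp.signals l M → M.EmitSN from
    H M h _ M [] (Nat.lt_succ_self _) rfl
  intro K hK
  induction hK with
  | intro K _ ihK =>
    intro n
    induction n with
    | zero => intro M l h; omega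
    | succ n ihn =>
      intro M l hn hM
      refine ⟨_, fun M' hM' => ?_⟩
      cases hM' with
      | run hs =>
        exact ihK _ (hM ▸ hs.signals l) _ M' l (Nat.lt_succ_self _) rfl
      | emit op V =>
        refine ihn M' (l ++ [(op, V)]) ?_ ?_
        · simp only [Cmp.signal.sizeOf_spec] at hn; omega
        · rw [hM, Cmp.signals_append]; rfl

theorem Cmp.EmitSN.sn_of_transGen {M N : Cmp S B} (h : M.EmitSN)
    (hN : Relation.TransGen (fun M' M : Cmp S B => Cmp.EmitStep M M') N M) : N.SN :=
  Subrelation.accessible (fun hs => .run hs) (h.inv_of_transGen hN)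

theorem Cmp.SN.signal {M : Cmp S B} (h : M.SN) (op : S) (V : Val S B) :
    (Cmp.signal op V M).SN := by
  induction h with
  | intro M _ ih =>
    refine ⟨_, fun T hT => ?_⟩
    cases hT with
    | ctx_signal _ _ hs => exact ih _ hs

/-! ### Stacks of evaluation frames -/

/-- The evaluation frames `let x = [ ] in N` and `↓ op (V, [ ])`. No two of them interact, so
a stack of such frames reduces only together with the computation plugged into it. -/
inductive Frame (S : Type u) (B : Type v) : Type (max u v)
  | letin : Cmp S B → Frame S B
  | interrupt : S → Val S B → Frame S B

/-- Plugs a computation into a frame. -/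
def Frame.plug : Frame S B → Cmp S B → Cmp S B
  | .letin N, M => .letin M N
  | .interrupt op V, M => .interrupt op V M

/-- Weakening of a frame by one fresh innermost variable. -/
def Frame.wk : Frame S B → Frame S B
  | .letin N => .letin N.wkUnder
  | .interrupt op V => .interrupt op V.wk

/-- Plugs a computation into a stack of frames; the head of the list is the innermost frame. -/
def plug : List (Frame S B) → Cmp S B → Cmp S B
  | [], M => M
  | f :: E, M => plug E (f.plug M)

theorem Cmp.Step.framePlug {M M' : Cmp S B} (h : Cmp.Step M M') :
    ∀ f : Frame S B, Cmp.Step (f.plug M) (f.plug M')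
  | .letin _ => .ctx_let _ h
  | .interrupt _ _ => .ctx_interrupt _ _ h

theorem Cmp.Step.plug {M M' : Cmp S B} (h : Cmp.Step M M') (E : List (Frame S B)) :
    Cmp.Step (plug E M) (plug E M') := by
  induction E generalizing M M' with
  | nil => exact h
  | cons f E ih => exact ih (h.framePlug f)

theorem step_plug_frame {f : Frame S B} {M T : Cmp S B} (E : List (Frame S B))
    (h : Cmp.Step (plug E (f.plug M)) T) :
    ∃ K, Cmp.Step (f.plug M) K ∧ T = plug E K := by
  induction E generalizing f M with
  | nil => exact ⟨T, h, rfl⟩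
  | cons g E ih =>
    obtain ⟨K, hK, rfl⟩ := ih (f := g) (M := f.plug M) h
    cases g <;> cases f <;> cases hK <;> exact ⟨_, by assumption, rfl⟩

/-- A reduction of `E[M]` happens within `M` or at the boundary between `M` and the innermost
frame of `E`. -/
theorem step_plug {M T : Cmp S B} {E : List (Frame S B)} (h : Cmp.Step (plug E M) T) :
    (∃ M', Cmp.Step M M' ∧ T = plug E M') ∨
      ∃ f E' K, E = f :: E' ∧ Cmp.Step (f.plug M) K ∧ T = plug E' K := by
  cases E with
  | nil => exact .inl ⟨T, h, rfl⟩
  | cons f E =>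
    obtain ⟨K, hK, hT⟩ := step_plug_frame E h
    exact .inr ⟨f, E, K, rfl, hK, hT⟩

theorem step_plug_app {V W : Val S B} {T : Cmp S B} {E : List (Frame S B)}
    (h : Cmp.Step (plug E (.app V W)) T) :
    ∃ M', Cmp.Step (.app V W) M' ∧ T = plug E M' := by
  rcases step_plug h with h | ⟨f, E', K, rfl, hK, rfl⟩
  · exact h
  · cases f <;> cases hK <;> exact ⟨_, by assumption, rfl⟩

/-- By induction on the normalisation of `E[N]`, then on `E`: while the signal floats out of the
stack, the computation left after removing it stays the same. -/
theorem Cmp.SN.plug_signal {E : List (Frame S B)} {N : Cmp S B} (h : (plug E N).SN) (op : S)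
    (V : Val S B) : (plug E (.signal op V N)).SN := by
  generalize hK : plug E N = K at h
  induction h generalizing E N with
  | intro K hacc ihK =>
    induction E generalizing N with
    | nil =>
      have : N.SN := by rw [show N = K from hK]; exact ⟨_, hacc⟩
      exact this.signal op V
    | cons f E ihE =>
      refine ⟨_, fun T hT => ?_⟩
      rcases step_plug hT with ⟨M', hM', rfl⟩ | ⟨_, _, K', ⟨⟩, hK', rfl⟩
      · cases hM' with
        | ctx_signal _ _ hs => exact ihK _ (hK ▸ hs.plug (f :: E)) rfl
      · cases f <;> cases hK'
        case letin.let_signal N' => exact ihE (N := .letin N N') hK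
        case letin.ctx_let N' _ hs =>
          cases hs with
          | ctx_signal _ _ hs => exact ihK _ (hK ▸ hs.plug (.letin N' :: E)) rfl
        case interrupt.interrupt_signal op' W => exact ihE (N := .interrupt op' W N) hK
        case interrupt.ctx_interrupt op' W _ hs =>
          cases hs with
          | ctx_signal _ _ hs => exact ihK _ (hK ▸ hs.plug (.interrupt op' W :: E)) rfl

theorem Cmp.SN.plug_let_ret {E : List (Frame S B)} {M : Cmp S B} {V : Val S B}
    (h : (plug E (M.inst V)).SN) : (plug E (.letin (.ret V) M)).SN := by
  refine ⟨_, fun T hT => ?_⟩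
  obtain ⟨K, hK, rfl⟩ := step_plug_frame (f := .letin M) (M := .ret V) E hT
  cases hK with
  | let_ret => exact h
  | ctx_let _ hs => cases hs

theorem Cmp.SN.plug_interrupt_ret {E : List (Frame S B)} {V : Val S B}
    (h : (plug E (.ret V)).SN) (op : S) (W : Val S B) :
    (plug E (.interrupt op W (.ret V))).SN := by
  refine ⟨_, fun T hT => ?_⟩
  obtain ⟨K, hK, rfl⟩ := step_plug_frame (f := .interrupt op W) (M := .ret V) E hT
  cases hK with
  | interrupt_ret => exact h
  | ctx_interrupt _ _ hs => cases hs

/-- Floating a frame into the scope of a binder commutes with instantiating that binder. -/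
theorem Frame.wk_plug_inst (f : Frame S B) (M : Cmp S B) (W : Val S B) :
    (f.wk.plug M).inst W = f.plug (M.inst W) := by
  cases f with
  | letin N =>
    simp only [Frame.wk, Frame.plug, Cmp.inst, Cmp.subst, Cmp.wkUnder_subst_singleSub]
  | interrupt op V => simp only [Frame.wk, Frame.plug, Cmp.inst, Cmp.subst, Val.wk_subst_singleSub]

theorem Cmp.SN.plug_await {E : List (Frame S B)} {V : Val S B} {M : Cmp S B}
    (h : ∀ W, V = .promise W → (plug E (M.inst W)).SN) : (plug E (.await V M)).SN := by
  induction E generalizing M with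
  | nil =>
    refine ⟨_, fun T hT => ?_⟩
    cases hT with
    | await_promise W => exact h W rfl
  | cons f E ih =>
    have key : (plug E (.await V (f.wk.plug M))).SN :=
      ih fun W hW => by rw [Frame.wk_plug_inst]; exact h W hW
    refine ⟨_, fun T hT => ?_⟩
    rcases step_plug hT with ⟨M', hM', rfl⟩ | ⟨_, _, K', ⟨⟩, hK', rfl⟩
    · cases hM' with
      | await_promise W => exact h W rfl
    · cases f <;> cases hK'
      case letin.let_await => exact key
      case interrupt.interrupt_await => exact key
      all_goals
        rename_i hs
        cases hs with
        | await_promise W => exact h W rfl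

/-- The signal in `E[↑ op (V, N)]` can float out of the stack and be emitted, leaving `E[N]`. -/
theorem emit_plug_signal (E : List (Frame S B)) (op : S) (V : Val S B) (N : Cmp S B) :
    Relation.TransGen (fun M' M : Cmp S B => Cmp.EmitStep M M') (plug E N)
      (plug E (.signal op V N)) := by
  induction E generalizing N with
  | nil => exact .single (.emit op V N)
  | cons f E ih =>
    refine (ih (f.plug N)).tail (.run (Cmp.Step.plug ?_ E))
    cases f with
    | letin N' => exact .let_signal _ _ _ _
    | interrupt op' W => exact .interrupt_signal _ _ _ _ _

/-! ### Reducibility -/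

/-- Reducible values, by recursion on the type. A value of function type is reducible if its
applications to reducible arguments normalise in every stack in which all reducible results
normalise; effect annotations play no role. -/
def RedV : VTy S B → Val S B → Prop
  | .base _, _ => True
  | .arrow X Y _, V => ∀ W, RedV X W → ∀ E : List (Frame S B),
      (∀ U, RedV Y U → (plug E (.ret U)).SN) → (plug E (.app V W)).SN
  | .promise X, V => ∀ W, V = .promise W → RedV X W

/-- Reducible stacks: those in which all reducible values normalise. -/
def RedK (X : VTy S B) (E : List (Frame S B)) : Prop := ∀ U, RedV X U → (plug E (.ret U)).SN

/-- Reducible computations: those that normalise in all reducible stacks. -/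
def RedC (X : VTy S B) (M : Cmp S B) : Prop := ∀ E, RedK X E → (plug E M).SN

theorem redK_nil (X : VTy S B) : RedK X [] := fun _ _ => ⟨_, fun _ hT => nomatch hT⟩

theorem redV_var (X : VTy S B) (n : ℕ) : RedV X (.var n) := by
  cases X with
  | base b => trivial
  | arrow X Y e =>
    intro W _ E _
    refine ⟨_, fun T hT => ?_⟩
    obtain ⟨_, hs, _⟩ := step_plug_app hT
    cases hs
  | promise X => intro W hW; cases hW

theorem redK_letin {X Y : VTy S B} {E : List (Frame S B)} {N : Cmp S B} (hE : RedK Y E)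
    (hN : ∀ W, RedV X W → RedC Y (N.inst W)) : RedK X (.letin N :: E) :=
  fun U hU => Cmp.SN.plug_let_ret (hN U hU E hE)

theorem redK_interrupt {X : VTy S B} {E : List (Frame S B)} (hE : RedK X E) (op : S)
    (V : Val S B) : RedK X (.interrupt op V :: E) :=
  fun U hU => Cmp.SN.plug_interrupt_ret (hE U hU) op V

theorem redV_lam {X Y : VTy S B} {e : Eff S} {Z : VTy S B} {M : Cmp S B}
    (h : ∀ W, RedV X W → RedC Y (M.inst W)) : RedV (.arrow X Y e) (.lam Z M) := by
  intro W hW E hE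
  refine ⟨_, fun T hT => ?_⟩
  obtain ⟨_, hs, rfl⟩ := step_plug_app hT
  cases hs with
  | beta => exact h W hW E hE

/-- Stacks around an interrupt handler normalise as soon as they normalise around all instances
`N[W/p]` of its continuation. The premise is invariant under floating the handler out of
the stack. When the handler is triggered, it says that the stack
`E[let p = [ ] in ↓ op (V, N)]` surrounding the handler body is reducible. -/
theorem sn_plug_handler {X : VTy S B} {op : S} {M N : Cmp S B} {E : List (Frame S B)}
    (hM : ∀ V, RedC (.promise X) (M.inst V))
    (hN : ∀ W, RedV (.promise X) W → (plug E (N.inst W)).SN) :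
    (plug E (.handler op M N)).SN := by
  -- The promise variable itself is a reducible instance, and supplies the induction measure.
  have h0 := (hN (.var 0) (redV_var _ 0)).emitSN.transGen
  generalize hK : plug E (N.inst (.var 0)) = K at h0
  induction h0 generalizing E N with
  | intro K _ ihK =>
    have inner : ∀ {E : List (Frame S B)} {N T : Cmp S B},
        (∀ W, RedV (.promise X) W → (plug E (N.inst W)).SN) → plug E (N.inst (.var 0)) = K →
        Cmp.Step (.handler op M N) T → (plug E T).SN := by
      intro E N T hN hK hT
      cases hT with
      | handler_signal _ op' V _ N' =>
        refine Cmp.SN.plug_signal (ihK _ ?_ (fun W hW => ?_) rfl) op' V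
        · exact hK ▸ emit_plug_signal E op' (V.wk.subst (singleSub (.var 0))) (N'.inst (.var 0))
        · exact Cmp.EmitSN.sn_of_transGen (hN W hW).emitSN
            (emit_plug_signal E op' (V.wk.subst (singleSub W)) (N'.inst W))
      | @ctx_handler _ _ _ N' hs =>
        refine ihK _ ?_ (fun W hW => ?_) rfl
        · exact hK ▸ Relation.TransGen.single (.run ((hs.subst (singleSub (.var 0))).plug E))
        · exact (hN W hW).inv ((hs.subst (singleSub W)).plug E)
    induction E generalizing N with
    | nil => exact ⟨_, fun T hT => inner (E := []) hN hK hT⟩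
    | cons f E ihE =>
      have float : (plug E (.handler op M (f.wk.plug N))).SN :=
        ihE (fun W hW => by rw [Frame.wk_plug_inst]; exact hN W hW)
          (by rw [Frame.wk_plug_inst]; exact hK)
      refine ⟨_, fun T hT => ?_⟩
      rcases step_plug hT with ⟨M', hM', rfl⟩ | ⟨_, _, K', ⟨⟩, hK', rfl⟩
      · exact inner hN hK hM'
      · cases f <;> cases hK'
        case letin.let_handler => exact float
        case interrupt.interrupt_handler_ne => exact float
        case interrupt.interrupt_handler_same V =>
          refine hM V (.letin (.interrupt op V.wk N) :: E) fun W hW => Cmp.SN.plug_let_ret ?_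
          simp only [Cmp.inst, Cmp.subst, Val.wk_subst_singleSub]
          exact hN W hW
        case letin.ctx_let N' _ hs => exact inner (E := .letin N' :: E) hN hK hs
        case interrupt.ctx_interrupt op' V _ hs =>
          exact inner (E := .interrupt op' V :: E) hN hK hs

/-! ### Strong normalisation of well-typed computations -/

theorem redV_consSub {Γ : Ctx S B} {σ : ℕ → Val S B} {X : VTy S B} {W : Val S B}
    (hσ : ∀ n Y, Γ[n]? = some Y → RedV Y (σ n)) (hW : RedV X W) :
    ∀ n Y, (X :: Γ)[n]? = some Y → RedV Y (consSub W σ n)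
  | 0, Y, h => by
      obtain rfl : X = Y := by simpa using h
      exact hW
  | n + 1, Y, h => hσ n Y (by simpa using h)

variable [DecidableEq S] {A : S → B}

mutual

/-- Well-typed values are reducible under reducible substitutions. -/
theorem HasVTy.redV : ∀ {Γ : Ctx S B} {V : Val S B} {X : VTy S B}, HasVTy A Γ V X →
    ∀ σ : ℕ → Val S B, (∀ n Y, Γ[n]? = some Y → RedV Y (σ n)) → RedV X (V.subst σ)
  | _, _, _, .var h, _, hσ => hσ _ _ h
  | _, _, _, .lam hM, σ, hσ => redV_lam fun W hW => by
      rw [Cmp.inst_subst_liftSub]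
      exact hM.redC _ (redV_consSub hσ hW)
  | _, _, _, .promise hV, σ, hσ => by
      intro W hW
      cases hW
      exact hV.redV σ hσ

/-- Well-typed computations are reducible under reducible substitutions. -/
theorem HasCTy.redC : ∀ {Γ : Ctx S B} {M : Cmp S B} {X : VTy S B} {e : Eff S}, HasCTy A Γ M X e →
    ∀ σ : ℕ → Val S B, (∀ n Y, Γ[n]? = some Y → RedV Y (σ n)) → RedC X (M.subst σ)
  | _, _, _, _, .ret hV, σ, hσ => fun _ hE => hE _ (hV.redV σ hσ)
  | _, _, _, _, .letin hM hN, σ, hσ => fun _ hE =>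
      hM.redC σ hσ _ (redK_letin hE fun W hW => by
        rw [Cmp.inst_subst_liftSub]
        exact hN.redC _ (redV_consSub hσ hW))
  | _, _, _, _, .app hV hW, σ, hσ => fun _ hE => hV.redV σ hσ _ (hW.redV σ hσ) _ hE
  | _, _, _, _, .signal _ _ hM, σ, hσ => fun _ hE => (hM.redC σ hσ _ hE).plug_signal _ _
  | _, _, _, _, .interrupt _ hM, σ, hσ => fun _ hE => hM.redC σ hσ _ (redK_interrupt hE _ _)
  | _, _, _, _, .handler (X := X) _ hM hN, σ, hσ => fun _ hE => by
      refine sn_plug_handler (X := X) (fun V => ?_) (fun W hW => ?_) <;> rw [Cmp.inst_subst_liftSub]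
      · exact hM.redC _ (redV_consSub hσ trivial)
      · exact hN.redC _ (redV_consSub hσ hW) _ hE
  | _, _, _, _, .await hV hM, σ, hσ => fun _ hE => Cmp.SN.plug_await fun W hW => by
      rw [Cmp.inst_subst_liftSub]
      exact hM.redC _ (redV_consSub hσ (hV.redV σ hσ W hW)) _ hE
  | _, _, _, _, .sub hM _, σ, hσ => hM.redC σ hσ

end

theorem HasCTy.sn {Γ : Ctx S B} {M : Cmp S B} {X : VTy S B} {e : Eff S}
    (h : HasCTy A Γ M X e) : M.SN := by
  have := h.redC .var (fun n Y _ => redV_var Y n) [] (redK_nil X)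
  rwa [Cmp.subst_var] at this

end Normalisation

/-! ### Order and size of effect annotations -/

section Annotations

variable {S : Type u}

theorem Entry.le_refl : ∀ a : Entry S, a.le a
  | .bot => trivial
  | .node _ i => ⟨subset_rfl, fun s => Entry.le_refl (i s)⟩

theorem Entry.le_trans : ∀ {a b c : Entry S}, a.le b → b.le c → a.le c
  | .bot, _, _, _, _ => trivial
  | .node _ _, .bot, _, h, _ => h.elim
  | .node _ _, .node _ _, .bot, _, h => h.elim
  | .node _ _, .node _ _, .node _ _, h, h' =>
      ⟨h.1.trans h'.1, fun s => Entry.le_trans (h.2 s) (h'.2 s)⟩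

theorem Entry.le_sup_left : ∀ a b : Entry S, a.le (a.sup b)
  | .bot, _ => trivial
  | .node _ _, .bot => Entry.le_refl _
  | .node _ i, .node _ i' => ⟨Set.subset_union_left, fun s => Entry.le_sup_left (i s) (i' s)⟩

theorem Entry.le_sup_right : ∀ a b : Entry S, b.le (a.sup b)
  | .bot, b => Entry.le_refl b
  | .node _ _, .bot => trivial
  | .node _ i, .node _ i' => ⟨Set.subset_union_right, fun s => Entry.le_sup_right (i s) (i' s)⟩

theorem Eff.le_refl (e : Eff S) : Eff.le e e := ⟨subset_rfl, fun s => Entry.le_refl (e.2 s)⟩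

theorem Eff.le_trans {e e' e'' : Eff S} (h : Eff.le e e') (h' : Eff.le e' e'') : Eff.le e e'' :=
  ⟨h.1.trans h'.1, fun s => Entry.le_trans (h.2 s) (h'.2 s)⟩

theorem Eff.le_node {e e' : Eff S} (h : Eff.le e e') {op : S} {o : Set S} {i : Ann S}
    (he : e.2 op = .node o i) : ∃ o' i', e'.2 op = .node o' i' ∧ Eff.le (o, i) (o', i') := by
  have h2 := h.2 op
  rw [he] at h2
  cases he' : e'.2 op with
  | bot => rw [he'] at h2; exact h2.elim
  | node o' i' => rw [he'] at h2; exact ⟨o', i', rfl, h2⟩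

variable [DecidableEq S]

theorem Eff.act_of_bot {e : Eff S} {op : S} (h : e.2 op = .bot) : Eff.act op e = e := by
  simp only [Eff.act, h]

theorem Eff.act_of_node {e : Eff S} {op : S} {o : Set S} {i : Ann S} (h : e.2 op = .node o i) :
    Eff.act op e = (e.1 ∪ o, Ann.sup (Function.update e.2 op Entry.bot) i) := by
  simp only [Eff.act, h]

theorem Eff.subset_act (e : Eff S) (op : S) : e.1 ⊆ (Eff.act op e).1 := by
  cases h : e.2 op with
  | bot => rw [Eff.act_of_bot h]
  | node o i => rw [Eff.act_of_node h]; exact Set.subset_union_left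

theorem Eff.le_act_same {e : Eff S} {op : S} {o : Set S} {i : Ann S} (h : e.2 op = .node o i) :
    Eff.le (o, i) (Eff.act op e) := by
  rw [Eff.act_of_node h]
  exact ⟨Set.subset_union_right, fun s => Entry.le_sup_right _ _⟩

theorem Eff.le_act_ne {e : Eff S} {op op' : S} (hne : op ≠ op') :
    (e.2 op).le ((Eff.act op' e).2 op) := by
  cases h : e.2 op' with
  | bot => rw [Eff.act_of_bot h]; exact Entry.le_refl _
  | node o i =>
    rw [Eff.act_of_node h]
    have := Entry.le_sup_left ((Function.update e.2 op' Entry.bot) op) (i op)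
    nth_rewrite 1 [Function.update_of_ne hne] at this
    exact this

/-- The number of nodes of an entry, seen as a finite tree. -/
def Entry.size [Fintype S] : Entry S → ℕ
  | .bot => 0
  | .node _ i => 1 + ∑ s, Entry.size (i s)

/-- The number of nodes of the interrupt annotation `ι` in `(o, ι)`. -/
def Eff.size [Fintype S] (e : Eff S) : ℕ := ∑ s, (e.2 s).size

omit [DecidableEq S] in
theorem Entry.size_sup_le [Fintype S] :
    ∀ a b : Entry S, (a.sup b).size ≤ a.size + b.size
  | .bot, b => by simp [Entry.sup]
  | .node _ _, .bot => by simp [Entry.sup]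
  | .node _ i, .node _ i' => by
      have := Finset.sum_le_sum fun s (_ : s ∈ Finset.univ) => Entry.size_sup_le (i s) (i' s)
      rw [Finset.sum_add_distrib] at this
      simp only [Entry.sup, Entry.size]
      omega

/-- An interrupt that can trigger a handler consumes a node of the annotation: the subtree at `op`
loses its root and is merged into the rest, and joins do not duplicate nodes. -/
theorem Eff.size_act_lt [Fintype S] {e : Eff S} {op : S} {o : Set S} {i : Ann S}
    (h : e.2 op = .node o i) : (Eff.act op e).size < e.size := by
  rw [Eff.act_of_node h, Eff.size, Eff.size]
  have h1 := Finset.sum_le_sum fun s (_ : s ∈ Finset.univ) =>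
    Entry.size_sup_le (Function.update e.2 op Entry.bot s) (i s)
  rw [Finset.sum_add_distrib] at h1
  have h2 : ∑ s, (Function.update e.2 op Entry.bot s).size + (e.2 op).size
      = ∑ s, (e.2 s).size := by
    rw [← Finset.add_sum_erase Finset.univ (fun s => (e.2 s).size) (Finset.mem_univ op),
      ← Finset.add_sum_erase Finset.univ (fun s => (Function.update e.2 op Entry.bot s).size)
        (Finset.mem_univ op),
      Finset.sum_congr rfl fun s hs => by
        rw [Function.update_of_ne (Finset.ne_of_mem_erase hs)]]
    simp [Entry.size, Nat.add_comm]
  rw [h, Entry.size] at h2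
  exact lt_of_le_of_lt h1 (by omega)

end Annotations

/-! ### Erasure of ineffective interrupts -/

section Erasure

variable {S : Type u} {B : Type v} [DecidableEq S] {A : S → B}

mutual

/-- Erasure on values, see `ErasesC`. -/
inductive ErasesV (A : S → B) : Ctx S B → Val S B → Val S B → VTy S B → Prop
  | var {Γ : Ctx S B} {n : ℕ} {X : VTy S B} :
      Γ[n]? = some X → ErasesV A Γ (.var n) (.var n) X
  | lam {Γ : Ctx S B} {X Y : VTy S B} {e : Eff S} {M M' : Cmp S B} :
      ErasesC A (X :: Γ) M M' Y e → ErasesV A Γ (.lam X M) (.lam X M') (.arrow X Y e)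
  | promise {Γ : Ctx S B} {X : VTy S B} {V V' : Val S B} :
      ErasesV A Γ V V' X → ErasesV A Γ (.promise V) (.promise V') (.promise X)

/-- `ErasesC A Γ M M' X e`: the computation `M` is well-typed in `Γ` at `X ! e`, and `M'` results
from `M` by erasing some interrupts `↓ op (V, N)` at which the annotation of `N` is undefined at
`op`, so that `N` cannot react to them. The relation has the typing rules as its congruence rules;
its diagonal is the typing relation. -/
inductive ErasesC (A : S → B) : Ctx S B → Cmp S B → Cmp S B → VTy S B → Eff S → Prop
  | ret {Γ : Ctx S B} {V V' : Val S B} {X : VTy S B} {e : Eff S} :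
      ErasesV A Γ V V' X → ErasesC A Γ (.ret V) (.ret V') X e
  | letin {Γ : Ctx S B} {M M' N N' : Cmp S B} {X Y : VTy S B} {e : Eff S} :
      ErasesC A Γ M M' X e → ErasesC A (X :: Γ) N N' Y e →
      ErasesC A Γ (.letin M N) (.letin M' N') Y e
  | app {Γ : Ctx S B} {V V' W W' : Val S B} {X Y : VTy S B} {e : Eff S} :
      ErasesV A Γ V V' (.arrow X Y e) → ErasesV A Γ W W' X →
      ErasesC A Γ (.app V W) (.app V' W') Y e
  | signal {Γ : Ctx S B} {op : S} {V V' : Val S B} {M M' : Cmp S B} {X : VTy S B} {e : Eff S} :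
      op ∈ e.1 → ErasesV A Γ V V' (.base (A op)) → ErasesC A Γ M M' X e →
      ErasesC A Γ (.signal op V M) (.signal op V' M') X e
  | interrupt {Γ : Ctx S B} {op : S} {V V' : Val S B} {M M' : Cmp S B} {X : VTy S B} {e : Eff S} :
      ErasesV A Γ V V' (.base (A op)) → ErasesC A Γ M M' X e →
      ErasesC A Γ (.interrupt op V M) (.interrupt op V' M') X (Eff.act op e)
  | erase {Γ : Ctx S B} {op : S} {V V' : Val S B} {M M' : Cmp S B} {X : VTy S B} {e : Eff S} :
      e.2 op = Entry.bot → ErasesV A Γ V V' (.base (A op)) → ErasesC A Γ M M' X e →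
      ErasesC A Γ (.interrupt op V M) M' X e
  | handler {Γ : Ctx S B} {op : S} {M M' N N' : Cmp S B} {X Y : VTy S B} {e : Eff S}
      {o' : Set S} {i' : Ann S} :
      e.2 op = Entry.node o' i' →
      ErasesC A (.base (A op) :: Γ) M M' (.promise X) (o', i') →
      ErasesC A (.promise X :: Γ) N N' Y e →
      ErasesC A Γ (.handler op M N) (.handler op M' N') Y e
  | await {Γ : Ctx S B} {V V' : Val S B} {M M' : Cmp S B} {X Y : VTy S B} {e : Eff S} :
      ErasesV A Γ V V' (.promise X) → ErasesC A (X :: Γ) M M' Y e →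
      ErasesC A Γ (.await V M) (.await V' M') Y e
  | sub {Γ : Ctx S B} {M M' : Cmp S B} {X : VTy S B} {e e' : Eff S} :
      ErasesC A Γ M M' X e → Eff.le e e' → ErasesC A Γ M M' X e'

end

mutual

theorem HasVTy.erases : ∀ {Γ : Ctx S B} {V : Val S B} {X : VTy S B}, HasVTy A Γ V X →
    ErasesV A Γ V V X
  | _, _, _, .var h => .var h
  | _, _, _, .lam h => .lam h.erases
  | _, _, _, .promise h => .promise h.erases

theorem HasCTy.erases : ∀ {Γ : Ctx S B} {M : Cmp S B} {X : VTy S B} {e : Eff S},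
    HasCTy A Γ M X e → ErasesC A Γ M M X e
  | _, _, _, _, .ret h => .ret h.erases
  | _, _, _, _, .letin h h' => .letin h.erases h'.erases
  | _, _, _, _, .app h h' => .app h.erases h'.erases
  | _, _, _, _, .signal h h' h'' => .signal h h'.erases h''.erases
  | _, _, _, _, .interrupt h h' => .interrupt h.erases h'.erases
  | _, _, _, _, .handler h h' h'' => .handler h h'.erases h''.erases
  | _, _, _, _, .await h h' => .await h.erases h'.erases
  | _, _, _, _, .sub h h' => .sub h.erases h'

end

mutual

theorem ErasesV.hasVTy : ∀ {Γ : Ctx S B} {V V' : Val S B} {X : VTy S B},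
    ErasesV A Γ V V' X → HasVTy A Γ V X
  | _, _, _, _, .var h => .var h
  | _, _, _, _, .lam h => .lam h.hasCTy
  | _, _, _, _, .promise h => .promise h.hasVTy

theorem ErasesC.hasCTy : ∀ {Γ : Ctx S B} {M M' : Cmp S B} {X : VTy S B} {e : Eff S},
    ErasesC A Γ M M' X e → HasCTy A Γ M X e
  | _, _, _, _, _, .ret h => .ret h.hasVTy
  | _, _, _, _, _, .letin h h' => .letin h.hasCTy h'.hasCTy
  | _, _, _, _, _, .app h h' => .app h.hasVTy h'.hasVTy
  | _, _, _, _, _, .signal h h' h'' => .signal h h'.hasVTy h''.hasCTy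
  | _, _, _, _, _, .interrupt h h' => .interrupt h.hasVTy h'.hasCTy
  | _, _, _, _, _, .erase h h' h'' => by
      have := HasCTy.interrupt h'.hasVTy h''.hasCTy
      rwa [Eff.act_of_bot h] at this
  | _, _, _, _, _, .handler h h' h'' => .handler h h'.hasCTy h''.hasCTy
  | _, _, _, _, _, .await h h' => .await h.hasVTy h'.hasCTy
  | _, _, _, _, _, .sub h h' => .sub h.hasCTy h'

end

/-- The renaming `ρ` is well-typed from `Γ` to `Δ`. -/
def RenTy (Γ Δ : Ctx S B) (ρ : ℕ → ℕ) : Prop := ∀ n X, Γ[n]? = some X → Δ[ρ n]? = some X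

omit [DecidableEq S] in
theorem RenTy.lift {Γ Δ : Ctx S B} {ρ : ℕ → ℕ} (h : RenTy Γ Δ ρ) (X : VTy S B) :
    RenTy (X :: Γ) (X :: Δ) (liftRen ρ)
  | 0, _, hn => hn
  | n + 1, Y, hn => h n Y hn

omit [DecidableEq S] in
theorem RenTy.succ (Γ : Ctx S B) (X : VTy S B) : RenTy Γ (X :: Γ) Nat.succ :=
  fun _ _ h => h

mutual

theorem ErasesV.rename : ∀ {Γ : Ctx S B} {V V' : Val S B} {X : VTy S B}, ErasesV A Γ V V' X →
    ∀ {Δ : Ctx S B} {ρ : ℕ → ℕ}, RenTy Γ Δ ρ → ErasesV A Δ (V.rename ρ) (V'.rename ρ) X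
  | _, _, _, _, .var h, _, _, hρ => .var (hρ _ _ h)
  | _, _, _, _, .lam h, _, _, hρ => .lam (h.rename (hρ.lift _))
  | _, _, _, _, .promise h, _, _, hρ => .promise (h.rename hρ)

theorem ErasesC.rename : ∀ {Γ : Ctx S B} {M M' : Cmp S B} {X : VTy S B} {e : Eff S},
    ErasesC A Γ M M' X e → ∀ {Δ : Ctx S B} {ρ : ℕ → ℕ}, RenTy Γ Δ ρ →
    ErasesC A Δ (M.rename ρ) (M'.rename ρ) X e
  | _, _, _, _, _, .ret h, _, _, hρ => .ret (h.rename hρ)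
  | _, _, _, _, _, .letin h h', _, _, hρ => .letin (h.rename hρ) (h'.rename (hρ.lift _))
  | _, _, _, _, _, .app h h', _, _, hρ => .app (h.rename hρ) (h'.rename hρ)
  | _, _, _, _, _, .signal h h' h'', _, _, hρ => .signal h (h'.rename hρ) (h''.rename hρ)
  | _, _, _, _, _, .interrupt h h', _, _, hρ => .interrupt (h.rename hρ) (h'.rename hρ)
  | _, _, _, _, _, .erase h h' h'', _, _, hρ => .erase h (h'.rename hρ) (h''.rename hρ)
  | _, _, _, _, _, .handler h h' h'', _, _, hρ =>
      .handler h (h'.rename (hρ.lift _)) (h''.rename (hρ.lift _))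
  | _, _, _, _, _, .await h h', _, _, hρ => .await (h.rename hρ) (h'.rename (hρ.lift _))
  | _, _, _, _, _, .sub h h', _, _, hρ => .sub (h.rename hρ) h'

end

theorem ErasesV.wk {Γ : Ctx S B} {V V' : Val S B} {X : VTy S B} (h : ErasesV A Γ V V' X)
    (Y : VTy S B) : ErasesV A (Y :: Γ) V.wk V'.wk X :=
  h.rename (RenTy.succ Γ Y)

theorem ErasesC.wkUnder {Γ : Ctx S B} {M M' : Cmp S B} {X Z : VTy S B} {e : Eff S}
    (h : ErasesC A (X :: Γ) M M' Z e) (Y : VTy S B) :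
    ErasesC A (X :: Y :: Γ) M.wkUnder M'.wkUnder Z e :=
  h.rename ((RenTy.succ Γ Y).lift X)

/-- The substitution `σ` is well-typed from `Γ` to `Δ`, and `σ'` is an erasure of it. -/
def ErasesSub (A : S → B) (Γ Δ : Ctx S B) (σ σ' : ℕ → Val S B) : Prop :=
  ∀ n X, Γ[n]? = some X → ErasesV A Δ (σ n) (σ' n) X

theorem ErasesSub.lift {Γ Δ : Ctx S B} {σ σ' : ℕ → Val S B} (h : ErasesSub A Γ Δ σ σ')
    (X : VTy S B) : ErasesSub A (X :: Γ) (X :: Δ) (liftSub σ) (liftSub σ')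
  | 0, _, hn => .var hn
  | n + 1, Y, hn => (h n Y hn).wk X

theorem ErasesSub.single {Γ : Ctx S B} {V V' : Val S B} {X : VTy S B} (h : ErasesV A Γ V V' X) :
    ErasesSub A (X :: Γ) Γ (singleSub V) (singleSub V')
  | 0, Y, hn => by
      obtain rfl : X = Y := by simpa using hn
      exact h
  | n + 1, _, hn => .var hn

mutual

theorem ErasesV.subst : ∀ {Γ : Ctx S B} {V V' : Val S B} {X : VTy S B}, ErasesV A Γ V V' X →
    ∀ {Δ : Ctx S B} {σ σ' : ℕ → Val S B}, ErasesSub A Γ Δ σ σ' →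
    ErasesV A Δ (V.subst σ) (V'.subst σ') X
  | _, _, _, _, .var h, _, _, _, hσ => hσ _ _ h
  | _, _, _, _, .lam h, _, _, _, hσ => .lam (h.subst (hσ.lift _))
  | _, _, _, _, .promise h, _, _, _, hσ => .promise (h.subst hσ)

theorem ErasesC.subst : ∀ {Γ : Ctx S B} {M M' : Cmp S B} {X : VTy S B} {e : Eff S},
    ErasesC A Γ M M' X e → ∀ {Δ : Ctx S B} {σ σ' : ℕ → Val S B}, ErasesSub A Γ Δ σ σ' →
    ErasesC A Δ (M.subst σ) (M'.subst σ') X e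
  | _, _, _, _, _, .ret h, _, _, _, hσ => .ret (h.subst hσ)
  | _, _, _, _, _, .letin h h', _, _, _, hσ => .letin (h.subst hσ) (h'.subst (hσ.lift _))
  | _, _, _, _, _, .app h h', _, _, _, hσ => .app (h.subst hσ) (h'.subst hσ)
  | _, _, _, _, _, .signal h h' h'', _, _, _, hσ => .signal h (h'.subst hσ) (h''.subst hσ)
  | _, _, _, _, _, .interrupt h h', _, _, _, hσ => .interrupt (h.subst hσ) (h'.subst hσ)
  | _, _, _, _, _, .erase h h' h'', _, _, _, hσ => .erase h (h'.subst hσ) (h''.subst hσ)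
  | _, _, _, _, _, .handler h h' h'', _, _, _, hσ =>
      .handler h (h'.subst (hσ.lift _)) (h''.subst (hσ.lift _))
  | _, _, _, _, _, .await h h', _, _, _, hσ => .await (h.subst hσ) (h'.subst (hσ.lift _))
  | _, _, _, _, _, .sub h h', _, _, _, hσ => .sub (h.subst hσ) h'

end

theorem ErasesC.inst {Γ : Ctx S B} {M M' : Cmp S B} {V V' : Val S B} {X Y : VTy S B} {e : Eff S}
    (hM : ErasesC A (X :: Γ) M M' Y e) (hV : ErasesV A Γ V V' X) :
    ErasesC A Γ (M.inst V) (M'.inst V') Y e :=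
  hM.subst (.single hV)

/-! ### Inversion of erasure, up to sub-effecting -/

theorem ErasesC.ret_inv {Γ : Ctx S B} {V : Val S B} {K : Cmp S B} {X : VTy S B} {e : Eff S}
    (h : ErasesC A Γ (.ret V) K X e) : ∃ V', K = .ret V' ∧ ErasesV A Γ V V' X := by
  generalize hM : Cmp.ret V = M at h
  induction h using ErasesC.rec (motive_1 := fun _ _ _ _ _ => True) with
  | sub _ _ ih => exact ih hM
  | ret hV => cases hM; exact ⟨_, rfl, hV⟩
  | _ => trivial

theorem ErasesC.letin_inv {Γ : Ctx S B} {M N K : Cmp S B} {Y : VTy S B} {e : Eff S}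
    (h : ErasesC A Γ (.letin M N) K Y e) : ∃ X M' N', K = .letin M' N' ∧ ErasesC A Γ M M' X e ∧
      ErasesC A (X :: Γ) N N' Y e := by
  generalize hL : Cmp.letin M N = L at h
  induction h using ErasesC.rec (motive_1 := fun _ _ _ _ _ => True) with
  | sub _ hle ih =>
    obtain ⟨X, M', N', rfl, h1, h2⟩ := ih hL
    exact ⟨X, M', N', rfl, h1.sub hle, h2.sub hle⟩
  | letin h1 h2 => cases hL; exact ⟨_, _, _, rfl, h1, h2⟩
  | _ => trivial

theorem ErasesC.app_inv {Γ : Ctx S B} {V W : Val S B} {K : Cmp S B} {Y : VTy S B} {e : Eff S}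
    (h : ErasesC A Γ (.app V W) K Y e) : ∃ X e' V' W', Eff.le e' e ∧ K = .app V' W' ∧
      ErasesV A Γ V V' (.arrow X Y e') ∧ ErasesV A Γ W W' X := by
  generalize hL : Cmp.app V W = L at h
  induction h using ErasesC.rec (motive_1 := fun _ _ _ _ _ => True) with
  | sub _ hle ih =>
    obtain ⟨X, e', V', W', hle', rfl, h1, h2⟩ := ih hL
    exact ⟨X, e', V', W', Eff.le_trans hle' hle, rfl, h1, h2⟩
  | app h1 h2 => cases hL; exact ⟨_, _, _, _, Eff.le_refl _, rfl, h1, h2⟩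
  | _ => trivial

theorem ErasesC.signal_inv {Γ : Ctx S B} {op : S} {V : Val S B} {M K : Cmp S B} {X : VTy S B}
    {e : Eff S} (h : ErasesC A Γ (.signal op V M) K X e) : ∃ V' M', K = .signal op V' M' ∧
      op ∈ e.1 ∧ ErasesV A Γ V V' (.base (A op)) ∧ ErasesC A Γ M M' X e := by
  generalize hL : Cmp.signal op V M = L at h
  induction h using ErasesC.rec (motive_1 := fun _ _ _ _ _ => True) with
  | sub _ hle ih =>
    obtain ⟨V', M', rfl, h1, h2, h3⟩ := ih hL
    exact ⟨V', M', rfl, hle.1 h1, h2, h3.sub hle⟩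
  | signal h1 h2 h3 => cases hL; exact ⟨_, _, rfl, h1, h2, h3⟩
  | _ => trivial

theorem ErasesC.interrupt_inv {Γ : Ctx S B} {op : S} {V : Val S B} {M K : Cmp S B} {X : VTy S B}
    {e : Eff S} (h : ErasesC A Γ (.interrupt op V M) K X e) :
    ∃ V' M' e', ErasesV A Γ V V' (.base (A op)) ∧ ErasesC A Γ M M' X e' ∧
      ((K = .interrupt op V' M' ∧ Eff.le (Eff.act op e') e) ∨
        (K = M' ∧ e'.2 op = .bot ∧ Eff.le e' e)) := by
  generalize hL : Cmp.interrupt op V M = L at h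
  induction h using ErasesC.rec (motive_1 := fun _ _ _ _ _ => True) with
  | sub _ hle ih =>
    obtain ⟨V', M', e', h1, h2, ⟨rfl, h3⟩ | ⟨rfl, h3, h4⟩⟩ := ih hL
    · exact ⟨V', M', e', h1, h2, .inl ⟨rfl, Eff.le_trans h3 hle⟩⟩
    · exact ⟨V', _, e', h1, h2, .inr ⟨rfl, h3, Eff.le_trans h4 hle⟩⟩
  | interrupt h1 h2 => cases hL; exact ⟨_, _, _, h1, h2, .inl ⟨rfl, Eff.le_refl _⟩⟩
  | erase h1 h2 h3 => cases hL; exact ⟨_, _, _, h2, h3, .inr ⟨rfl, h1, Eff.le_refl _⟩⟩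
  | _ => trivial

theorem ErasesC.handler_inv {Γ : Ctx S B} {op : S} {M N K : Cmp S B} {Y : VTy S B} {e : Eff S}
    (h : ErasesC A Γ (.handler op M N) K Y e) : ∃ X M' N' o' i', K = .handler op M' N' ∧
      e.2 op = .node o' i' ∧ ErasesC A (.base (A op) :: Γ) M M' (.promise X) (o', i') ∧
      ErasesC A (.promise X :: Γ) N N' Y e := by
  generalize hL : Cmp.handler op M N = L at h
  induction h using ErasesC.rec (motive_1 := fun _ _ _ _ _ => True) with
  | sub _ hle ih =>
    obtain ⟨X, M', N', o', i', rfl, h1, h2, h3⟩ := ih hL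
    obtain ⟨o'', i'', h4, h5⟩ := Eff.le_node hle h1
    exact ⟨X, M', N', o'', i'', rfl, h4, h2.sub h5, h3.sub hle⟩
  | handler h1 h2 h3 => cases hL; exact ⟨_, _, _, _, _, rfl, h1, h2, h3⟩
  | _ => trivial

theorem ErasesC.await_inv {Γ : Ctx S B} {V : Val S B} {M K : Cmp S B} {Y : VTy S B} {e : Eff S}
    (h : ErasesC A Γ (.await V M) K Y e) : ∃ X V' M', K = .await V' M' ∧
      ErasesV A Γ V V' (.promise X) ∧ ErasesC A (X :: Γ) M M' Y e := by
  generalize hL : Cmp.await V M = L at h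
  induction h using ErasesC.rec (motive_1 := fun _ _ _ _ _ => True) with
  | sub _ hle ih =>
    obtain ⟨X, V', M', rfl, h1, h2⟩ := ih hL
    exact ⟨X, V', M', rfl, h1, h2.sub hle⟩
  | await h1 h2 => cases hL; exact ⟨_, _, _, rfl, h1, h2⟩
  | _ => trivial

/-- Values of base type are variables. Hence an erasure of a payload that does not mention the
innermost variable does not mention it either. -/
theorem ErasesV.of_wk_base {Γ : Ctx S B} {V V' : Val S B} {Y : VTy S B} {b : B}
    (h : ErasesV A (Y :: Γ) V.wk V' (.base b)) : V' = V.wk ∧ ErasesV A Γ V V (.base b) := by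
  cases V with
  | var n => cases h with | var hn => exact ⟨rfl, .var hn⟩
  | lam => cases h
  | promise => cases h

/-! ### Erasure is a simulation -/

/-- Every reduction of `M` is matched by its erasure, with one reduction or with none. On the
diagonal this contains subject reduction. -/
theorem ErasesC.step {M M' : Cmp S B} (hs : Cmp.Step M M') :
    ∀ {Γ : Ctx S B} {K : Cmp S B} {X : VTy S B} {e : Eff S}, ErasesC A Γ M K X e →
      ∃ K', (K' = K ∨ Cmp.Step K K') ∧ ErasesC A Γ M' K' X e := by
  induction hs with
  | beta Z M V =>
    intro Γ K X e h
    obtain ⟨X', e', V', W', hle, rfl, h1, h2⟩ := h.app_inv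
    cases h1 with
    | lam h1 => exact ⟨_, .inr (.beta _ _ _), (h1.inst h2).sub hle⟩
  | let_ret V M =>
    intro Γ K X e h
    obtain ⟨Y, M', N', rfl, h1, h2⟩ := h.letin_inv
    obtain ⟨V', rfl, h3⟩ := h1.ret_inv
    exact ⟨_, .inr (.let_ret _ _), h2.inst h3⟩
  | let_signal op V M N =>
    intro Γ K X e h
    obtain ⟨Y, M', N', rfl, h1, h2⟩ := h.letin_inv
    obtain ⟨V', M'', rfl, h3, h4, h5⟩ := h1.signal_inv
    exact ⟨_, .inr (.let_signal _ _ _ _), .signal h3 h4 (.letin h5 h2)⟩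
  | let_handler op M N₁ N₂ =>
    intro Γ K X e h
    obtain ⟨Y, M', N', rfl, h1, h2⟩ := h.letin_inv
    obtain ⟨Z, M'', N'', o', i', rfl, h3, h4, h5⟩ := h1.handler_inv
    exact ⟨_, .inr (.let_handler _ _ _ _), .handler h3 h4 (.letin h5 (h2.wkUnder _))⟩
  | let_await V M N =>
    intro Γ K X e h
    obtain ⟨Y, M', N', rfl, h1, h2⟩ := h.letin_inv
    obtain ⟨Z, V', M'', rfl, h3, h4⟩ := h1.await_inv
    exact ⟨_, .inr (.let_await _ _ _), .await h3 (.letin h4 (h2.wkUnder _))⟩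
  | handler_signal op op' V M N =>
    intro Γ K X e h
    obtain ⟨Z, M', N', o', i', rfl, h1, h2, h3⟩ := h.handler_inv
    obtain ⟨V', M'', rfl, h4, h5, h6⟩ := h3.signal_inv
    obtain ⟨rfl, h7⟩ := h5.of_wk_base
    exact ⟨_, .inr (.handler_signal _ _ _ _ _), .signal h4 h7 (.handler h1 h2 h6)⟩
  | interrupt_ret op V W =>
    intro Γ K X e h
    obtain ⟨V', M', e', h1, h2, ⟨rfl, h3⟩ | ⟨rfl, h3, h4⟩⟩ := h.interrupt_inv
    · obtain ⟨W', rfl, h4⟩ := h2.ret_inv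
      exact ⟨_, .inr (.interrupt_ret _ _ _), .ret h4⟩
    · exact ⟨_, .inl rfl, h2.sub h4⟩
  | interrupt_signal op op' V W M =>
    intro Γ K X e h
    obtain ⟨V', M', e', h1, h2, ⟨rfl, h3⟩ | ⟨rfl, h3, h4⟩⟩ := h.interrupt_inv
    · obtain ⟨W', M'', rfl, h4, h5, h6⟩ := h2.signal_inv
      exact ⟨_, .inr (.interrupt_signal _ _ _ _ _),
        .sub (.signal (Eff.subset_act _ _ h4) h5 (.interrupt h1 h6)) h3⟩
    · obtain ⟨W', M'', rfl, h5, h6, h7⟩ := h2.signal_inv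
      exact ⟨_, .inl rfl, .sub (.signal h5 h6 (.erase h3 h1 h7)) h4⟩
  | interrupt_handler_same op V M N =>
    intro Γ K X e h
    obtain ⟨V', M', e', h1, h2, ⟨rfl, h3⟩ | ⟨rfl, h3, h4⟩⟩ := h.interrupt_inv
    · obtain ⟨Z, M'', N'', o', i', rfl, h4, h5, h6⟩ := h2.handler_inv
      exact ⟨_, .inr (.interrupt_handler_same _ _ _ _),
        .sub (.letin ((h5.inst h1).sub (Eff.le_act_same h4)) (.interrupt (h1.wk _) h6)) h3⟩
    · obtain ⟨Z, M'', N'', o', i', -, h5, -⟩ := h2.handler_inv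
      cases h3.symm.trans h5
  | interrupt_handler_ne op op' V M N hne =>
    intro Γ K X e h
    obtain ⟨V', M', e', h1, h2, ⟨rfl, h3⟩ | ⟨rfl, h3, h4⟩⟩ := h.interrupt_inv
    · obtain ⟨Z, M'', N'', o', i', rfl, h4, h5, h6⟩ := h2.handler_inv
      have hle := Eff.le_act_ne (e := e') hne
      rw [h4] at hle
      cases hact : (Eff.act op' e').2 op with
      | bot => rw [hact] at hle; exact hle.elim
      | node o'' i'' =>
        rw [hact] at hle
        exact ⟨_, .inr (.interrupt_handler_ne _ _ _ _ _ hne),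
          .sub (.handler hact (h5.sub hle) (.interrupt (h1.wk _) h6)) h3⟩
    · obtain ⟨Z, M'', N'', o', i', rfl, h5, h6, h7⟩ := h2.handler_inv
      exact ⟨_, .inl rfl, .sub (.handler h5 h6 (.erase h3 (h1.wk _) h7)) h4⟩
  | interrupt_await op V W M =>
    intro Γ K X e h
    obtain ⟨V', M', e', h1, h2, ⟨rfl, h3⟩ | ⟨rfl, h3, h4⟩⟩ := h.interrupt_inv
    · obtain ⟨Z, W', M'', rfl, h4, h5⟩ := h2.await_inv
      exact ⟨_, .inr (.interrupt_await _ _ _ _), .sub (.await h4 (.interrupt (h1.wk _) h5)) h3⟩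
    · obtain ⟨Z, W', M'', rfl, h5, h6⟩ := h2.await_inv
      exact ⟨_, .inl rfl, .sub (.await h5 (.erase h3 (h1.wk _) h6)) h4⟩
  | await_promise V M =>
    intro Γ K X e h
    obtain ⟨Z, W', M', rfl, h1, h2⟩ := h.await_inv
    cases h1 with
    | promise h1 => exact ⟨_, .inr (.await_promise _ _), h2.inst h1⟩
  | ctx_let N _ ih =>
    intro Γ K X e h
    obtain ⟨Y, M', N', rfl, h1, h2⟩ := h.letin_inv
    obtain ⟨K', rfl | hs, h3⟩ := ih h1
    · exact ⟨_, .inl rfl, .letin h3 h2⟩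
    · exact ⟨_, .inr (.ctx_let _ hs), .letin h3 h2⟩
  | ctx_signal op V _ ih =>
    intro Γ K X e h
    obtain ⟨V', M', rfl, h1, h2, h3⟩ := h.signal_inv
    obtain ⟨K', rfl | hs, h4⟩ := ih h3
    · exact ⟨_, .inl rfl, .signal h1 h2 h4⟩
    · exact ⟨_, .inr (.ctx_signal _ _ hs), .signal h1 h2 h4⟩
  | ctx_interrupt op V _ ih =>
    intro Γ K X e h
    obtain ⟨V', M', e', h1, h2, ⟨rfl, h3⟩ | ⟨rfl, h3, h4⟩⟩ := h.interrupt_inv <;>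
      obtain ⟨K', rfl | hs, h5⟩ := ih h2
    · exact ⟨_, .inl rfl, .sub (.interrupt h1 h5) h3⟩
    · exact ⟨_, .inr (.ctx_interrupt _ _ hs), .sub (.interrupt h1 h5) h3⟩
    · exact ⟨_, .inl rfl, .sub (.erase h3 h1 h5) h4⟩
    · exact ⟨_, .inr hs, .sub (.erase h3 h1 h5) h4⟩
  | ctx_handler op M _ ih =>
    intro Γ K X e h
    obtain ⟨Z, M', N', o', i', rfl, h1, h2, h3⟩ := h.handler_inv
    obtain ⟨K', rfl | hs, h4⟩ := ih h3
    · exact ⟨_, .inl rfl, .handler h1 h2 h4⟩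
    · exact ⟨_, .inr (.ctx_handler _ _ hs), .handler h1 h2 h4⟩

end Erasure

/-! ### Termination of processes -/

section Processes

variable {S : Type u} {B : Type v} [DecidableEq S] {A : S → B}

/-- A component of a process, together with an erasure of it and its effect annotation. -/
structure Comp (S : Type u) (B : Type v) where
  /-- the computation that is run -/
  cmp : Cmp S B
  /-- the erasure of the computation, which measures the signals that it can still emit -/
  erased : Cmp S B
  /-- the effect annotation of the computation -/
  eff : Eff S

/-- The computation is well-typed in `Γ`, and its erasure can only emit finitely many signals. -/
def Comp.Good (A : S → B) (Γ : Ctx S B) (c : Comp S B) : Prop :=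
  (∃ X, ErasesC A Γ c.cmp c.erased X c.eff) ∧ c.erased.EmitSN

theorem HasCTy.good {Γ : Ctx S B} {M : Cmp S B} {X : VTy S B} {e : Eff S}
    (h : HasCTy A Γ M X e) : Comp.Good A Γ ⟨M, M, e⟩ :=
  ⟨⟨X, h.erases⟩, h.sn.emitSN⟩

/-- Converse reduction out of normalising computations. -/
def SNRed (M' M : Cmp S B) : Prop := M.SN ∧ Cmp.Step M M'

/-- Converse reduction or emission out of computations that can only emit finitely many signals. -/
def EmitRed (M' M : Cmp S B) : Prop := M.EmitSN ∧ Cmp.EmitStep M M'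

theorem wellFounded_restrict_acc {α : Type*} (r : α → α → Prop) :
    WellFounded fun a b => Acc r b ∧ r a b := by
  refine ⟨fun a => ⟨_, fun b hb => ?_⟩⟩
  exact Subrelation.accessible (fun h => h.2) (hb.1.inv hb.2)

omit [DecidableEq S] in
theorem wellFounded_snRed : WellFounded (SNRed (S := S) (B := B)) :=
  wellFounded_restrict_acc _

omit [DecidableEq S] in
theorem wellFounded_emitRed : WellFounded (EmitRed (S := S) (B := B)) :=
  wellFounded_restrict_acc _

instance : Std.Irrefl (SNRed (S := S) (B := B)) := wellFounded_snRed.irrefl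
instance : Std.Irrefl (EmitRed (S := S) (B := B)) := wellFounded_emitRed.irrefl

theorem cutExpand_replace {α : Type*} {r : α → α → Prop} {a b : α} (h : r b a)
    (l₁ l₂ : List α) :
    Relation.CutExpand r ((l₁ ++ b :: l₂ : List α) : Multiset α) (l₁ ++ a :: l₂ : List α) := by
  refine ⟨{b}, a, by simpa using h, ?_⟩
  simp only [← Multiset.coe_add, ← Multiset.cons_coe, ← Multiset.singleton_add]
  abel

/-- The total size of the annotations of a process. -/
def totalSize [Fintype S] (C : List (Comp S B)) : ℕ := (C.map fun c => c.eff.size).sum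

/-- The erasures of the components of a process. -/
def erasures (C : List (Comp S B)) : Multiset (Cmp S B) := (C.map Comp.erased : List (Cmp S B))

/-- An interrupt either is effective for some component, whose annotation then shrinks, or can be
erased from all components. -/
theorem exists_comps_interrupt [Fintype S] {Γ : Ctx S B} {op : S} {V : Val S B}
    (hV : HasVTy A Γ V (.base (A op))) (C : List (Comp S B)) (hC : ∀ c ∈ C, c.Good A Γ) :
    ∃ C' : List (Comp S B), C'.map Comp.cmp = (C.map Comp.cmp).map (Cmp.interrupt op V) ∧
      (∀ c ∈ C', c.Good A Γ) ∧
      (totalSize C' < totalSize C ∨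
        (totalSize C' = totalSize C ∧ C'.map Comp.erased = C.map Comp.erased)) := by
  induction C with
  | nil => exact ⟨[], rfl, hC, .inr ⟨rfl, rfl⟩⟩
  | cons c C ih =>
    obtain ⟨C', h1, h2, h3⟩ := ih fun c hc => hC c (List.mem_cons_of_mem _ hc)
    obtain ⟨⟨X, hX⟩, hsn⟩ := hC c List.mem_cons_self
    cases he : c.eff.2 op with
    | bot =>
      refine ⟨⟨.interrupt op V c.cmp, c.erased, c.eff⟩ :: C', by simp [h1],
        List.forall_mem_cons.2 ⟨⟨⟨X, .erase he hV.erases hX⟩, hsn⟩, h2⟩, ?_⟩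
      simpa [totalSize] using h3
    | node o i =>
      refine ⟨⟨.interrupt op V c.cmp, .interrupt op V c.cmp, Eff.act op c.eff⟩ :: C', by simp [h1],
        List.forall_mem_cons.2 ⟨(HasCTy.interrupt hV hX.hasCTy).good, h2⟩, .inl ?_⟩
      have := Eff.size_act_lt he
      simp only [totalSize, List.map_cons, List.sum_cons] at h3 ⊢
      omega

/-- A broadcast shrinks the annotation of a component, or emits a signal of an erasure. -/
theorem Proc.Broadcast.exists_comps [Fintype S] {Γ : Ctx S B} {op : S} {V : Val S B}
    {P Q : Proc S B} (h : Proc.Broadcast op V P Q) :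
    ∀ C : List (Comp S B), C.map Comp.cmp = P → (∀ c ∈ C, c.Good A Γ) →
      HasVTy A Γ V (.base (A op)) ∧ ∃ C' : List (Comp S B), C'.map Comp.cmp = Q ∧
        (∀ c ∈ C', c.Good A Γ) ∧
        (totalSize C' < totalSize C ∨ (totalSize C' = totalSize C ∧
          ∃ l₁ l₂ K K', C.map Comp.erased = l₁ ++ K :: l₂ ∧
            C'.map Comp.erased = l₁ ++ K' :: l₂ ∧ EmitRed K' K)) := by
  induction h with
  | here M P =>
    intro C hP hC
    obtain ⟨c, C, rfl, hc, rfl⟩ := List.map_eq_cons_iff.1 hP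
    obtain ⟨⟨X, hX⟩, hsn⟩ := hC c List.mem_cons_self
    rw [hc] at hX
    obtain ⟨V', M', hM', -, hV, hM⟩ := hX.signal_inv
    have hstep : EmitRed M' c.erased := ⟨hsn, hM' ▸ .emit op V' M'⟩
    obtain ⟨C', h1, h2, h3⟩ := exists_comps_interrupt hV.hasVTy C
      fun c hc => hC c (List.mem_cons_of_mem _ hc)
    refine ⟨hV.hasVTy, ⟨M, M', c.eff⟩ :: C', by simp [h1],
      List.forall_mem_cons.2 ⟨⟨⟨X, hM⟩, hsn.inv hstep.2⟩, h2⟩, ?_⟩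
    rcases h3 with h3 | ⟨h3, h4⟩
    · exact .inl (by simpa [totalSize] using h3)
    · exact .inr ⟨by simpa [totalSize] using h3, [], _, _, _, rfl, by simp [h4], hstep⟩
  | there M _ ih =>
    intro C hP hC
    obtain ⟨c, C, rfl, rfl, hC'⟩ := List.map_eq_cons_iff.1 hP
    obtain ⟨hV, C', h1, h2, h3⟩ := ih C hC' fun c hc => hC c (List.mem_cons_of_mem _ hc)
    obtain ⟨⟨X, hX⟩, hsn⟩ := hC c List.mem_cons_self
    cases he : c.eff.2 op with
    | bot =>
      refine ⟨hV, ⟨.interrupt op V c.cmp, c.erased, c.eff⟩ :: C', by simp [h1],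
        List.forall_mem_cons.2 ⟨⟨⟨X, .erase he hV.erases hX⟩, hsn⟩, h2⟩, ?_⟩
      rcases h3 with h3 | ⟨h3, l₁, l₂, K, K', h4, h5, h6⟩
      · exact .inl (by simpa [totalSize] using h3)
      · exact .inr ⟨by simpa [totalSize] using h3, c.erased :: l₁, l₂, K, K', by simp [h4],
          by simp [h5], h6⟩
    | node o i =>
      refine ⟨hV, ⟨.interrupt op V c.cmp, .interrupt op V c.cmp, Eff.act op c.eff⟩ :: C',
        by simp [h1],
        List.forall_mem_cons.2 ⟨(HasCTy.interrupt hV hX.hasCTy).good, h2⟩, .inl ?_⟩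
      have := Eff.size_act_lt he
      simp only [totalSize, List.map_cons, List.sum_cons] at h3 ⊢
      omega

/-- Processes with good components are accessible, by lexicographic induction: effective
interrupts decrease the total size of the annotations, all other broadcasts reduce the
erasures, and reductions of components reduce the components without expanding the erasures. -/
theorem acc_of_good [Fintype S] {Γ : Ctx S B} (n : ℕ) :
    ∀ (H R : Multiset (Cmp S B)) (C : List (Comp S B)), totalSize C = n → erasures C = H →
      (C.map Comp.cmp : List (Cmp S B)) = R → (∀ c ∈ C, c.Good A Γ) →
      Acc (fun Q P : Proc S B => Proc.Step P Q) (C.map Comp.cmp) := by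
  induction n using Nat.strong_induction_on with
  | _ n ihn =>
  intro H
  induction H using wellFounded_emitRed.cutExpand.induction with
  | _ H ihH =>
  intro R
  induction R using wellFounded_snRed.cutExpand.induction with
  | _ R ihR =>
  intro C hn hH hR hC
  refine ⟨_, fun Q hQ => ?_⟩
  generalize hP : C.map Comp.cmp = P at hQ
  cases hQ with
  | @run P₁ P₂ M M' hs =>
    obtain ⟨C₁, C₂', rfl, rfl, h2⟩ := List.map_eq_append_iff.1 hP
    obtain ⟨c, C₂, rfl, rfl, rfl⟩ := List.map_eq_cons_iff.1 h2
    obtain ⟨⟨X, hX⟩, hsn⟩ := hC c (by simp)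
    obtain ⟨K, hK, hX'⟩ := hX.step hs
    have hsnK : K.EmitSN := by
      rcases hK with rfl | hK
      · exact hsn
      · exact hsn.inv (.run hK)
    have hmap : C₁.map Comp.cmp ++ M' :: C₂.map Comp.cmp =
        (C₁ ++ ⟨M', K, c.eff⟩ :: C₂).map Comp.cmp := by simp
    have hgood : ∀ d ∈ C₁ ++ ⟨M', K, c.eff⟩ :: C₂, d.Good A Γ := by
      intro d hd
      rcases List.mem_append.1 hd with hd | hd
      · exact hC d (by simp [hd])
      · rcases List.mem_cons.1 hd with rfl | hd
        · exact ⟨⟨X, hX'⟩, hsnK⟩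
        · exact hC d (by simp [hd])
    have hsize : totalSize (C₁ ++ ⟨M', K, c.eff⟩ :: C₂) = n := by
      rw [← hn]; simp [totalSize]
    rw [hmap]
    rcases hK with rfl | hK
    · refine ihR _ ?_ _ hsize ?_ rfl hgood
      · rw [← hR]
        simpa using cutExpand_replace (r := SNRed) ⟨hX.hasCTy.sn, hs⟩
          (C₁.map Comp.cmp) (C₂.map Comp.cmp)
      · rw [← hH]; simp [erasures]
    · refine ihH _ ?_ _ _ hsize rfl rfl hgood
      rw [← hH]
      simpa [erasures] using cutExpand_replace (r := EmitRed) ⟨hsn, .run hK⟩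
        (C₁.map Comp.erased) (C₂.map Comp.erased)
  | broadcast h =>
    obtain ⟨-, C', rfl, hgood, h3 | ⟨h3, l₁, l₂, K, K', h4, h5, h6⟩⟩ := h.exists_comps C hP hC
    · exact ihn _ (hn ▸ h3) _ _ C' rfl rfl rfl hgood
    · refine ihH _ ?_ _ C' (h3.trans hn) rfl rfl hgood
      rw [← hH, erasures, erasures, h4, h5]
      exact cutExpand_replace h6 l₁ l₂

theorem Proc.WellTyped.exists_comps {Γ : Ctx S B} {P : Proc S B}
    (h : ∀ M ∈ P, ∃ (X : VTy S B) (e : Eff S), HasCTy A Γ M X e) :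
    ∃ C : List (Comp S B), C.map Comp.cmp = P ∧ ∀ c ∈ C, c.Good A Γ := by
  induction P with
  | nil => exact ⟨[], rfl, by simp⟩
  | cons M P ih =>
    obtain ⟨C, h1, h2⟩ := ih fun N hN => h N (List.mem_cons_of_mem _ hN)
    obtain ⟨X, e, hM⟩ := h M List.mem_cons_self
    exact ⟨⟨M, M, e⟩ :: C, by simp [h1], List.forall_mem_cons.2 ⟨hM.good, h2⟩⟩

omit [DecidableEq S] in
theorem Proc.stronglyNormalising_of_acc {P : Proc S B}
    (h : Acc (fun Q P : Proc S B => Proc.Step P Q) P) : P.StronglyNormalising := by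
  induction h with
  | intro P _ ih =>
    rintro ⟨f, rfl, hf⟩
    exact ih (f 1) (hf 0) ⟨fun n => f (n + 1), rfl, fun n => hf (n + 1)⟩

end Processes

end AEff

theorem mainTheorem5 {S : Type*} {B : Type*} [Finite S] [DecidableEq S] (A : S → B)
    (Γ : AEff.Ctx S B) (P : AEff.Proc S B) (hP : AEff.Proc.WellTyped A Γ P) :
    AEff.Proc.StronglyNormalising P := by
  have := Fintype.ofFinite S
  obtain ⟨C, rfl, hC⟩ := AEff.Proc.WellTyped.exists_comps hP.2
  exact AEff.Proc.stronglyNormalising_of_acc (AEff.acc_of_good _ _ _ C rfl rfl rfl hC)
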